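/- **Cauchy–Goursat theorem for multivector fields.** Let $N \ge 1$, $m \ge 0$, and let $\mathcal G_m$ be the geometric (Clifford) algebra of Euclidean space $\mathbf R^m$, with $v^2 = |v|^2$ for vectors $v$; limits, continuity and integrals of $\mathcal G_m$-valued functions are taken componentwise. A $C^1$ singular $N$-cube in $\mathbf R^m$ is a $C^1$ map $\varphi : [0,1]^N \to \mathbf R^m$ whose Jacobian $J = |\partial_1\varphi \wedge \dots \wedge \partial_N\varphi|$ is positive on $(0,1)^N$. For $x \in (0,1)^N$ let $V = J(x)^{-1}\, \partial_1\varphi(x) \wedge \dots \wedge \partial_N\varphi(x)$ be the unit tangent pseudoscalar, and $V^\dagger$ its reverse. A cube $c \subseteq [0,1]^N$ means a nondegenerate closed cube with sides parallel to the axes; put $C = \varphi(c)$, $|C| = \int_c J\,dx$, and $$\int_{\partial C} dA\, F = \sum_{i=1}^N (-1)^{N-i}\left[\int_{s_i^+} - \int_{s_i^-}\right] \big(\partial_1\varphi \wedge \dots \wedge \widehat{\partial_i\varphi} \wedge \dots \wedge \partial_N\varphi\big)\; F(\varphi(x))\; dx_1 \cdots \widehat{dx_i} \cdots dx_N ,$$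 where $s_i^{+}$ and $s_i^-$ are the faces of $c$ on which $x_i$ is largest and smallest. The tangential derivative of a $\mathcal G_m$-valued function $F$ at $X = \varphi(x)$ along $\varphi$ is $$\nabla_V F(X) = V^\dagger \lim_{x \in c,\ \operatorname{diam} c \to 0} \frac{1}{|C|} \int_{\partial C} dA\, F ,$$ and is said to exist if this limit exists. A $C^1$ $N$-chain is a formal integer combination $M = \sum_k a_k \varphi_k$ (a finite sum, $a_k \ne 0$) of $C^1$ singular $N$-cubes in $\mathbf R^m$, and $\int_{\partial M} dA\, F = \sum_k a_k \int_{\partial \varphi_k([0,1]^N)} dA\, F$. **Theorem.** Let $F$ be a multivector valued function defined on $\bigcup_k \varphi_k([0,1]^N)$ and continuous there. Suppose that for every $k$ and every $x \in (0,1)^N$ such that $\varphi_k(x)$ does not lie on the image of a face of any of the cubes $\varphi_l$ of the chain, $\nabla_V F$ exists at $\varphi_k(x)$ along $\varphi_k$ and equals $0$. Then $$\int_{\partial M} dA\, F = 0 .$$ No differentiability of $F$ and no continuity or integrability of a derivative is assumed. -/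

import Mathlib

open MeasureTheory Filter Topology

noncomputable section

namespace GeometricCalculus

/-! ### Multivectors: the geometric (Clifford) algebra of Euclidean space -/

/-- The Euclidean space `ℝ^m`. -/
abbrev Space (m : ℕ) : Type := EuclideanSpace ℝ (Fin m)

/-- The quadratic form `v ↦ ⟪v, v⟫` of Euclidean space. -/
def quadForm (m : ℕ) : QuadraticForm ℝ (Space m) :=
  LinearMap.BilinMap.toQuadraticMap (innerₗ (Space m))

theorem quadForm_apply (m : ℕ) (v : Space m) : quadForm m v = ‖v‖ ^ 2 := by
  simp [quadForm]

/-- The algebra of multivectors of `ℝ^m`, in which every vector satisfies `v * v = ‖v‖ ^ 2`. -/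
abbrev Multivector (m : ℕ) : Type := CliffordAlgebra (quadForm m)

/-- A vector, regarded as a multivector. -/
abbrev vec {m : ℕ} (v : Space m) : Multivector m := CliffordAlgebra.ι (quadForm m) v

/-- The standard basis `e_S = ⋀_{i ∈ S} e_i`, `S ⊆ {1, …, m}`, of the algebra of multivectors. -/
def bladeBasis (m : ℕ) : Module.Basis (Finset (Fin m)) ℝ (Multivector m) :=
  (EuclideanSpace.basisFun (Fin m) ℝ).toBasis.ExteriorAlgebra.map
    (CliffordAlgebra.equivExterior (quadForm m)).symm

/-- The components of a multivector in the standard basis. -/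
def components (m : ℕ) : Multivector m ≃ₗ[ℝ] EuclideanSpace ℝ (Finset (Fin m)) :=
  (bladeBasis m).equivFun.trans (WithLp.linearEquiv 2 ℝ (Finset (Fin m) → ℝ)).symm

/-- The norm of a multivector is the Euclidean norm of its components; so limits, continuity and
integrals of multivector valued functions are the componentwise ones. -/
instance instNormedAddCommGroupMultivector (m : ℕ) : NormedAddCommGroup (Multivector m) :=
  NormedAddCommGroup.induced (Multivector m) (EuclideanSpace ℝ (Finset (Fin m)))
    (components m) (components m).injective

instance instNormedSpaceMultivector (m : ℕ) : NormedSpace ℝ (Multivector m) :=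
  NormedSpace.induced ℝ (Multivector m) (EuclideanSpace ℝ (Finset (Fin m))) (components m)

instance instFiniteDimensionalMultivector (m : ℕ) : FiniteDimensional ℝ (Multivector m) :=
  Module.Finite.of_basis (bladeBasis m)

/-- The outer product `v_1 ∧ ⋯ ∧ v_k` of vectors: the antisymmetrized geometric product. -/
def blade {m k : ℕ} (v : Fin k → Space m) : Multivector m :=
  (k.factorial : ℝ)⁻¹ •
    ∑ σ : Equiv.Perm (Fin k),
      ((Equiv.Perm.sign σ : ℤ) : ℝ) • (List.ofFn fun i => vec (v (σ i))).prod

/-! ### Singular cubes and chains -/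

/-- The closed unit cube `[0,1]^k`. -/
def unitCube (k : ℕ) : Set (Fin k → ℝ) := Set.Icc 0 1

/-- The open unit cube `(0,1)^k`. -/
def openUnitCube (k : ℕ) : Set (Fin k → ℝ) := {x | ∀ i, 0 < x i ∧ x i < 1}

/-- The closed cube with lowest corner `a`, side `h`, and sides parallel to the axes. -/
def cube {k : ℕ} (a : Fin k → ℝ) (h : ℝ) : Set (Fin k → ℝ) := Set.Icc a (fun i => a i + h)

/-- The partial derivative `∂_j φ (x)` of a map on `[0,1]^k` (one-sided at boundary points). -/
def partialDeriv {k m : ℕ} (φ : (Fin k → ℝ) → Space m) (x : Fin k → ℝ) (j : Fin k) : Space m :=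
  fderivWithin ℝ φ (unitCube k) x (Pi.single j 1)

/-- The Jacobian `J(x) = |∂_1 φ ∧ ⋯ ∧ ∂_k φ| = √ det (⟪∂_i φ, ∂_j φ⟫)`. -/
def jacobian {k m : ℕ} (φ : (Fin k → ℝ) → Space m) (x : Fin k → ℝ) : ℝ :=
  Real.sqrt (Matrix.gram ℝ (partialDeriv φ x)).det

/-- A `C^1` singular `k`-cube in `ℝ^m`: a `C^1` map on `[0,1]^k` whose Jacobian is positive on
`(0,1)^k`. Only the values of `toFun` on `[0,1]^k` matter. -/
structure SingularCube (k m : ℕ) where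
  toFun : (Fin k → ℝ) → Space m
  contDiffOn : ContDiffOn ℝ 1 toFun (unitCube k)
  jacobian_pos : ∀ x ∈ openUnitCube k, 0 < jacobian toFun x

/-- A `C^1` `k`-chain in `ℝ^m`: a formal integer combination of `C^1` singular `k`-cubes. -/
abbrev Chain (k m : ℕ) : Type := SingularCube k m →₀ ℤ

/-- The point set `M` of a chain: the union of the images of its cubes. -/
def Chain.carrier {k m : ℕ} (M : Chain k m) : Set (Space m) :=
  ⋃ φ ∈ M.support, φ.toFun '' unitCube k

/-- The union of the images of all faces of all the cubes of a chain. It contains the point set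
of the boundary chain `∂M` (faces that cancel in `∂M` are included here as well). -/
def Chain.boundaryCarrier {k m : ℕ} (M : Chain k m) : Set (Space m) :=
  ⋃ φ ∈ M.support, φ.toFun '' (unitCube k \ openUnitCube k)

/-! ### Directed integrals over boundaries and the tangential derivative -/

section

variable {n m : ℕ}

/-- The directed integral `∫ dA F` over the part of the image of `φ` that is parametrized by the
`n`-cube `{x | x_i = t, (x_j)_{j ≠ i} ∈ cube b h}`, with
`dA = ∂_1 φ ∧ ⋯ ∧ (∂_i φ omitted) ∧ ⋯ ∧ ∂_{n+1} φ` times Lebesgue measure. -/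
def faceIntegral (φ : (Fin (n + 1) → ℝ) → Space m) (F : Space m → Multivector m)
    (i : Fin (n + 1)) (t : ℝ) (b : Fin n → ℝ) (h : ℝ) : Multivector m :=
  ∫ y in cube b h,
    blade (fun j : Fin n =>
        partialDeriv φ (Fin.insertNth (α := fun _ => ℝ) i t y) (i.succAbove j)) *
      F (φ (Fin.insertNth (α := fun _ => ℝ) i t y))

/-- The directed integral `∫_{∂C} dA F`, where `C = φ(c)`, `c = cube a h`. The tangent of `∂c` on
the face with outward normal `± e_i` is
`± v e_i = ± (-1)^(N - i) e_1 ∧ ⋯ ∧ (e_i omitted) ∧ ⋯ ∧ e_N`, where `N = n + 1` and `i` counts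
from `1`; as `i : Fin (n + 1)` counts from `0`, the sign is `(-1)^(n + i)`. -/
def boundaryIntegral (φ : (Fin (n + 1) → ℝ) → Space m) (F : Space m → Multivector m)
    (a : Fin (n + 1) → ℝ) (h : ℝ) : Multivector m :=
  ∑ i : Fin (n + 1), (-1 : ℝ) ^ (n + (i : ℕ)) •
    (faceIntegral φ F i (a i + h) (fun j => a (i.succAbove j)) h -
      faceIntegral φ F i (a i) (fun j => a (i.succAbove j)) h)

/-- The directed integral `∫_{∂M} dA F` over the boundary of a chain. -/
def Chain.boundaryIntegral (M : Chain (n + 1) m) (F : Space m → Multivector m) : Multivector m :=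
  M.sum fun φ z => (z : ℝ) • GeometricCalculus.boundaryIntegral φ.toFun F 0 1

/-- The `k`-dimensional volume `|C|` of `C = φ(c)`, `c = cube a h`. -/
def imageVolume {k : ℕ} (φ : (Fin k → ℝ) → Space m) (a : Fin k → ℝ) (h : ℝ) : ℝ :=
  ∫ x in cube a h, jacobian φ x

/-- The tangent `V`: the unit positively oriented pseudoscalar of the tangent algebra. -/
def tangent {k : ℕ} (φ : (Fin k → ℝ) → Space m) (x : Fin k → ℝ) : Multivector m :=
  (jacobian φ x)⁻¹ • blade (partialDeriv φ x)

/-- The filter of cubes `c = cube a h ⊆ [0,1]^k` with `x ∈ c` and `diam c → 0`; the cube is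
represented by the pair `(a, h)`. -/
def cubesShrinkingTo {k : ℕ} (x : Fin k → ℝ) : Filter ((Fin k → ℝ) × ℝ) :=
  comap Prod.snd (𝓝[>] (0 : ℝ)) ⊓ 𝓟 {c | x ∈ cube c.1 c.2 ∧ cube c.1 c.2 ⊆ unitCube k}

/-- `F` has the tangential derivative `D` at the point `X = φ(x)`:
`D = V(X)† lim (1 / |C|) ∫_{∂C} dA F`, the limit (whose existence is part of the assertion) being
over the cubes `c` with `x ∈ c` and `diam c → 0`, with `C = φ(c)`. -/
def HasTangentialDerivAt (φ : (Fin (n + 1) → ℝ) → Space m) (F : Space m → Multivector m)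
    (x : Fin (n + 1) → ℝ) (D : Multivector m) : Prop :=
  ∃ L : Multivector m,
    Tendsto (fun c : (Fin (n + 1) → ℝ) × ℝ =>
        (imageVolume φ c.1 c.2)⁻¹ • boundaryIntegral φ F c.1 c.2)
      (cubesShrinkingTo x) (𝓝 L) ∧
    D = CliffordAlgebra.reverse (tangent φ x) * L

end

end GeometricCalculus

end

namespace GeometricCalculus

/-! ### Multivector algebra -/

/-! The directed integral over the boundary of a cube is the outward `flux` of a continuous field,
`boundaryField`, on the parameter cube, and flux is additive under subdivision because inner faces
cancel (`flux_subdivide`). This makes Goursat's bisection argument available in every dimension;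
each cube of the chain turns out to contribute zero by itself.

On a small cube whose points all have vanishing tangential derivative, the tangent is an invertible
multivector (`isUnit_tangent`), so the limit defining the derivative is itself zero. The flux is
then `o(h ^ (n + 1))` at each point, and bisection forces it to vanish
(`flux_eq_zero_of_hasTangentialDerivAt`).

The derivative is not controlled where `φ` meets the image of a face of a cube of the chain. For
constant `F` the integrand is the pullback of a constant, hence closed, form, so its flux is zero
(`flux_pullback`, by mollification because `φ` is only `C^1`). Subtracting a constant bounds the
flux through a cube of side `h` by the oscillation of `F` times `h ^ n`
(`exists_norm_flux_le_oscillation`). Since `φ` is locally bi-Lipschitz and face images are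
`n`-dimensional, only `O(k ^ n)` of `k ^ (n + 1)` equal parts are affected
(`exists_card_meeting_le`). Their total flux is at most a constant times the oscillation at scale `h
/ k`, which tends to zero by uniform continuity (`exists_flux_eq_zero`).

These local facts glue by bisection on `[δ, 1 - δ] ^ (n + 1)`, and `δ → 0` reaches the unit cube
(`flux_unitCube_eq_zero`). -/

instance instContinuousMulMultivector (m : ℕ) : ContinuousMul (Multivector m) where
  continuous_mul :=
    ((LinearMap.mul ℝ (Multivector m)).toContinuousBilinearMap.continuous₂ : _)

theorem continuous_vec (m : ℕ) : Continuous (vec : Space m → Multivector m) :=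
  LinearMap.continuous_of_finiteDimensional _

theorem exists_norm_mul_le (m : ℕ) :
    ∃ C : ℝ, 0 ≤ C ∧ ∀ a b : Multivector m, ‖a * b‖ ≤ C * ‖a‖ * ‖b‖ :=
  ⟨‖(LinearMap.mul ℝ (Multivector m)).toContinuousBilinearMap‖, norm_nonneg _, fun a b =>
    (LinearMap.mul ℝ (Multivector m)).toContinuousBilinearMap.le_opNorm₂ a b⟩

theorem continuous_prod_ofFn_vec (m k : ℕ) :
    Continuous fun v : Fin k → Space m => (List.ofFn fun i => vec (v i)).prod := by
  induction k with
  | zero => simpa using continuous_const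
  | succ k ih =>
    simp only [List.ofFn_succ, List.prod_cons]
    exact ((continuous_vec m).comp (continuous_apply 0)).mul
      (ih.comp (continuous_pi fun i => continuous_apply i.succ))

/-- The product of vectors as a multilinear map. -/
noncomputable def vecProd (m k : ℕ) :
    MultilinearMap ℝ (fun _ : Fin k => Space m) (Multivector m) :=
  (MultilinearMap.mkPiAlgebraFin ℝ k (Multivector m)).compLinearMap
    fun _ => CliffordAlgebra.ι (quadForm m)

theorem vecProd_apply {m k : ℕ} (v : Fin k → Space m) :
    vecProd m k v = (List.ofFn fun i => vec (v i)).prod := by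
  simp [vecProd]

theorem blade_eq_alternatization {m k : ℕ} (v : Fin k → Space m) :
    blade v = (k.factorial : ℝ)⁻¹ • MultilinearMap.alternatization (vecProd m k) v := by
  simp only [blade, MultilinearMap.alternatization_apply, MultilinearMap.domDomCongr_apply,
    vecProd_apply]
  congr 1

theorem continuous_blade (m k : ℕ) : Continuous (blade : (Fin k → Space m) → Multivector m) := by
  unfold blade
  refine Continuous.fun_const_smul ?_ _
  refine continuous_finsetSum _ fun σ _ => ?_
  refine Continuous.fun_const_smul ?_ _
  have h : Continuous fun (v : Fin k → Space m) (i : Fin k) => v (σ i) :=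
    continuous_pi fun i => continuous_apply (σ i)
  exact (continuous_prod_ofFn_vec m k).comp h

/-- The outer product as a continuous alternating map. -/
noncomputable def bladeForm (m k : ℕ) : Space m [⋀^Fin k]→L[ℝ] Multivector m where
  toMultilinearMap :=
    ((k.factorial : ℝ)⁻¹ • MultilinearMap.alternatization (vecProd m k)).toMultilinearMap
  map_eq_zero_of_eq' :=
    ((k.factorial : ℝ)⁻¹ • MultilinearMap.alternatization (vecProd m k)).map_eq_zero_of_eq'
  cont := by
    refine (continuous_blade m k).congr fun v => ?_
    rw [blade_eq_alternatization]; rfl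

theorem bladeForm_apply {m k : ℕ} (v : Fin k → Space m) : bladeForm m k v = blade v := by
  rw [blade_eq_alternatization]; rfl

/-- Exchanging two adjacent anticommuting factors changes the sign of a product. -/
theorem prod_ofFn_comp_swap {A : Type*} [Ring A] {k : ℕ} (f : Fin (k + 1) → A) (i : Fin k)
    (h : f i.castSucc * f i.succ = -(f i.succ * f i.castSucc)) :
    (List.ofFn (f ∘ Equiv.swap i.castSucc i.succ)).prod = -(List.ofFn f).prod := by
  induction k with
  | zero => exact i.elim0
  | succ k ih =>
    cases i using Fin.cases with
    | zero =>
      have h2 : ∀ j : Fin k, Equiv.swap (0 : Fin (k + 2)) 1 j.succ.succ = j.succ.succ := fun j =>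
        Equiv.swap_apply_of_ne_of_ne (Fin.succ_ne_zero _)
          (by rw [← Fin.succ_zero_eq_one]; exact fun e => Fin.succ_ne_zero _ (Fin.succ_injective _ e))
      simp only [Fin.castSucc_zero, Fin.succ_zero_eq_one] at h ⊢
      simp only [List.ofFn_succ, Function.comp, List.prod_cons, Fin.succ_zero_eq_one,
        Equiv.swap_apply_left, Equiv.swap_apply_right, h2]
      rw [← mul_assoc, ← mul_assoc, h, neg_mul, neg_neg]
    | succ i =>
      have h0 : Equiv.swap i.succ.castSucc i.succ.succ 0 = 0 :=
        Equiv.swap_apply_of_ne_of_ne (by simp [Fin.ext_iff]) (Fin.succ_ne_zero _).symm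
      have h1 : ∀ j : Fin (k + 1), Equiv.swap i.succ.castSucc i.succ.succ j.succ =
          (Equiv.swap i.castSucc i.succ j).succ := by
        intro j
        rw [← Fin.succ_castSucc, (Fin.succ_injective _).swap_apply]
      rw [List.ofFn_succ, List.ofFn_succ (f := f), List.prod_cons, List.prod_cons]
      have := ih (fun j => f j.succ) i (by simpa using h)
      simp only [Function.comp_def, h0, h1] at this ⊢
      rw [this, mul_neg]

theorem isOrtho_quadForm {m : ℕ} {v w : Space m} (h : inner ℝ v w = 0) :
    (quadForm m).IsOrtho v w := by
  rw [QuadraticMap.isOrtho_def, quadForm_apply, quadForm_apply, quadForm_apply,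
    @norm_add_sq_real, h]
  ring

/-- The outer product of orthogonal vectors is their geometric product. -/
theorem blade_of_orthogonal {m k : ℕ} (e : Fin k → Space m)
    (he : Pairwise fun i j => inner ℝ (e i) (e j) = 0) :
    blade e = (List.ofFn fun i => vec (e i)).prod := by
  have key : ∀ σ : Equiv.Perm (Fin k), (List.ofFn fun i => vec (e (σ i))).prod =
      ((Equiv.Perm.sign σ : ℤ) : ℝ) • (List.ofFn fun i => vec (e i)).prod := by
    cases k with
    | zero => intro σ; simp [Subsingleton.elim σ 1]
    | succ k =>
      intro σ
      -- Adjacent transpositions generate the symmetric group, and each one exchanges two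
      -- anticommuting vectors.
      have hσ : σ ∈ Submonoid.closure
          (Set.range fun i : Fin k => Equiv.swap i.castSucc i.succ) := by
        rw [Equiv.Perm.mclosure_swap_castSucc_succ]; trivial
      induction hσ using Submonoid.closure_induction_right with
      | one => simp
      | mul_right τ _ y hy ih =>
        obtain ⟨i, rfl⟩ := hy
        have hne : i.castSucc ≠ i.succ := (Fin.castSucc_lt_succ).ne
        have := prod_ofFn_comp_swap (fun j => vec (e (τ j))) i
          (CliffordAlgebra.ι_mul_ι_comm_of_isOrtho
            (isOrtho_quadForm (he fun h => hne (τ.injective h))))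
        simp only [Function.comp_def] at this
        simp only [Equiv.Perm.coe_mul, Function.comp_apply, this, ih, Equiv.Perm.sign_mul,
          Equiv.Perm.sign_swap hne]
        simp
  unfold blade
  simp only [key, smul_smul]
  rw [← Finset.sum_smul, smul_smul]
  have : ∀ σ : Equiv.Perm (Fin k),
      ((Equiv.Perm.sign σ : ℤ) : ℝ) * ((Equiv.Perm.sign σ : ℤ) : ℝ) = 1 := by
    intro σ
    rw [← Int.cast_mul, ← Units.val_mul, Int.units_mul_self]; simp
  simp [this, Fintype.card_perm, Nat.factorial_ne_zero]

/-- The square of `v` is the nonzero scalar `‖v‖ ^ 2`. -/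
theorem isUnit_vec {m : ℕ} {v : Space m} (hv : v ≠ 0) : IsUnit (vec v) := by
  have h : vec v * vec v = algebraMap ℝ _ (‖v‖ ^ 2) := by
    rw [← quadForm_apply]; exact CliffordAlgebra.ι_sq_scalar _ _
  have hu : IsUnit (vec v * vec v) := by
    rw [h]; exact (IsUnit.mk0 _ (by positivity)).map _
  exact (Commute.refl (vec v)).isUnit_mul_iff.1 hu |>.1

theorem isUnit_prod_ofFn {A : Type*} [Monoid A] {k : ℕ} (f : Fin k → A)
    (h : ∀ i, IsUnit (f i)) : IsUnit (List.ofFn f).prod := by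
  induction k with
  | zero => simp
  | succ k ih =>
    rw [List.ofFn_succ, List.prod_cons]
    exact (h 0).mul (ih _ fun i => h i.succ)

theorem linearIndependent_of_det_gram_ne_zero {E : Type*} [NormedAddCommGroup E]
    [InnerProductSpace ℝ E] {k : ℕ} (v : Fin k → E) (h : (Matrix.gram ℝ v).det ≠ 0) :
    LinearIndependent ℝ v := by
  rw [Fintype.linearIndependent_iff]
  intro c hc
  have : Matrix.mulVec (Matrix.gram ℝ v) c = 0 := by
    ext i
    have h1 : inner ℝ (v i) (∑ j, c j • v j) = 0 := by rw [hc, inner_zero_right]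
    simpa [Matrix.mulVec, dotProduct, inner_sum, inner_smul_right, mul_comm] using h1
  exact fun i => congrFun (Matrix.eq_zero_of_mulVec_eq_zero h this) i

/-- The outer product of linearly independent vectors is invertible. -/
theorem isUnit_blade {m k : ℕ} {v : Fin k → Space m} (hv : LinearIndependent ℝ v) :
    IsUnit (blade v) := by
  set W := Submodule.span ℝ (Set.range v)
  have hk : Module.finrank ℝ W = k := by
    simpa using finrank_span_eq_card hv
  let e : OrthonormalBasis (Fin k) ℝ W :=
    (stdOrthonormalBasis ℝ W).reindex (finCongr hk)
  let b : Module.Basis (Fin k) ℝ W := Module.Basis.span hv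
  let g : W [⋀^Fin k]→ₗ[ℝ] Multivector m :=
    (bladeForm m k).toAlternatingMap.compLinearMap W.subtype
  -- A `k`-form on a `k`-dimensional space is a multiple of the determinant. Hence `blade v` is a
  -- nonzero multiple of a product of orthonormal vectors, each of them invertible.
  have hg : ∀ w, g w = e.toBasis.det w • g e := by
    have : g = ((LinearMap.toSpanSingleton ℝ _ (g e)).compAlternatingMap e.toBasis.det) := by
      refine Module.Basis.ext_alternating e.toBasis fun i hi => ?_
      let σ : Equiv.Perm (Fin k) := Equiv.ofBijective i (Finite.injective_iff_bijective.1 hi)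
      have e1 : (fun j => e.toBasis (i j)) = e.toBasis ∘ σ := rfl
      rw [e1, AlternatingMap.map_perm, AlternatingMap.map_perm]
      have hd : e.toBasis.det e = 1 := by
        rw [← OrthonormalBasis.coe_toBasis]; exact e.toBasis.det_self
      simp [hd]
    intro w
    conv_lhs => rw [this]
    simp
  have h1 : blade v = e.toBasis.det b • blade (fun i => (e i : Space m)) := by
    rw [← bladeForm_apply, ← bladeForm_apply]
    have := hg b
    have hb : (fun i => ((b i : W) : Space m)) = v := by
      ext1 i; exact congrArg Subtype.val (Module.Basis.span_apply hv i)
    calc _ = g b := by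
            change _ = bladeForm m k (fun i => ((b i : W) : Space m)); rw [hb]
      _ = _ := this
  rw [h1, blade_of_orthogonal]
  · have hu : IsUnit (e.toBasis.det b) := e.toBasis.isUnit_det b
    have : IsUnit (List.ofFn fun i => vec ((e i : W) : Space m)).prod := by
      refine isUnit_prod_ofFn _ fun i => isUnit_vec ?_
      simpa using e.orthonormal.ne_zero i
    rw [Algebra.smul_def]
    exact (hu.map _).mul this
  · intro i j hij
    exact e.orthonormal.2 hij

theorem isUnit_reverse {m : ℕ} {a : Multivector m} (ha : IsUnit a) :
    IsUnit (CliffordAlgebra.reverse a) := by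
  obtain ⟨b, h1, h2⟩ := isUnit_iff_exists.1 ha
  refine isUnit_iff_exists.2 ⟨CliffordAlgebra.reverse b, ?_, ?_⟩
  · rw [← CliffordAlgebra.reverse.map_mul, h2, CliffordAlgebra.reverse.map_one]
  · rw [← CliffordAlgebra.reverse.map_mul, h1, CliffordAlgebra.reverse.map_one]

theorem linearIndependent_partialDeriv {k m : ℕ} {φ : (Fin k → ℝ) → Space m} {x : Fin k → ℝ}
    (h : 0 < jacobian φ x) : LinearIndependent ℝ (partialDeriv φ x) :=
  linearIndependent_of_det_gram_ne_zero _ (Real.sqrt_pos.1 h).ne'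

/-- This allows `V†` to be cancelled from the equation `V† * L = 0`. -/
theorem isUnit_tangent {k m : ℕ} {φ : (Fin k → ℝ) → Space m} {x : Fin k → ℝ}
    (h : 0 < jacobian φ x) : IsUnit (tangent φ x) := by
  unfold tangent
  rw [Algebra.smul_def]
  exact ((IsUnit.mk0 _ (inv_ne_zero h.ne')).map _).mul
    (isUnit_blade (linearIndependent_partialDeriv h))

/-! ### Fluxes through the boundaries of cubes -/

section Flux

variable {n : ℕ} {E : Type*} [NormedAddCommGroup E] [NormedSpace ℝ E]

/-- The outward flux of a vector field with components `G i` through the boundary of a cube. -/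
noncomputable def flux (G : Fin (n + 1) → (Fin (n + 1) → ℝ) → E) (a : Fin (n + 1) → ℝ) (h : ℝ) :
    E :=
  ∑ i : Fin (n + 1),
    ((∫ y in cube (fun j => a (i.succAbove j)) h,
        G i (Fin.insertNth (α := fun _ => ℝ) i (a i + h) y)) -
      ∫ y in cube (fun j => a (i.succAbove j)) h,
        G i (Fin.insertNth (α := fun _ => ℝ) i (a i) y))

/-! ### Cubes, their faces, and subdivision -/

theorem mem_cube {k : ℕ} {a x : Fin k → ℝ} {h : ℝ} :
    x ∈ cube a h ↔ ∀ i, a i ≤ x i ∧ x i ≤ a i + h := by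
  simp only [cube, Set.mem_Icc, Pi.le_def, forall_and]

theorem isCompact_cube {k : ℕ} (a : Fin k → ℝ) (h : ℝ) : IsCompact (cube a h) := isCompact_Icc

theorem unitCube_eq_cube (k : ℕ) : unitCube k = cube 0 1 := by
  ext x; simp [unitCube, cube, Set.mem_Icc, Pi.le_def]

theorem volume_real_cube {k : ℕ} (a : Fin k → ℝ) {h : ℝ} (hh : 0 ≤ h) :
    volume.real (cube a h) = h ^ k := by
  simp [Measure.real, cube, Real.volume_Icc_pi, hh]

theorem volume_cube_lt_top {k : ℕ} (a : Fin k → ℝ) (h : ℝ) : volume (cube a h) < ⊤ :=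
  (isCompact_cube a h).measure_lt_top

theorem insertNth_mem_cube {a : Fin (n + 1) → ℝ} {h : ℝ} {i : Fin (n + 1)} {t : ℝ}
    {y : Fin n → ℝ} (ht : a i ≤ t ∧ t ≤ a i + h) (hy : y ∈ cube (fun j => a (i.succAbove j)) h) :
    Fin.insertNth (α := fun _ => ℝ) i t y ∈ cube a h := by
  rw [mem_cube] at hy ⊢
  intro j
  rcases Fin.eq_self_or_eq_succAbove i j with rfl | ⟨j, rfl⟩
  · simpa using ht
  · simpa using hy j

theorem continuous_insertNth_const (i : Fin (n + 1)) (t : ℝ) :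
    Continuous fun y : Fin n → ℝ => Fin.insertNth (α := fun _ => ℝ) i t y :=
  Continuous.finInsertNth i continuous_const continuous_id

theorem continuousOn_comp_insertNth {X : Type*} [TopologicalSpace X]
    {g : (Fin (n + 1) → ℝ) → X} {a : Fin (n + 1) → ℝ} {h : ℝ}
    (hg : ContinuousOn g (cube a h)) {i : Fin (n + 1)} {t : ℝ} (ht : a i ≤ t ∧ t ≤ a i + h) :
    ContinuousOn (fun y : Fin n → ℝ => g (Fin.insertNth (α := fun _ => ℝ) i t y))
      (cube (fun j => a (i.succAbove j)) h) :=
  hg.comp (continuous_insertNth_const i t).continuousOn fun _ hy => insertNth_mem_cube ht hy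

theorem norm_flux_le {G : Fin (n + 1) → (Fin (n + 1) → ℝ) → E} {a : Fin (n + 1) → ℝ} {h B : ℝ}
    (hh : 0 ≤ h) (hB : ∀ i, ∀ x ∈ cube a h, ‖G i x‖ ≤ B) :
    ‖flux G a h‖ ≤ 2 * (n + 1) * B * h ^ n := by
  have key : ∀ i : Fin (n + 1), ∀ t, a i ≤ t ∧ t ≤ a i + h →
      ‖∫ y in cube (fun j => a (i.succAbove j)) h,
        G i (Fin.insertNth (α := fun _ => ℝ) i t y)‖ ≤ B * h ^ n := by
    intro i t ht
    rw [← volume_real_cube (fun j => a (i.succAbove j)) hh]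
    exact norm_setIntegral_le_of_norm_le_const (volume_cube_lt_top _ _)
      fun y hy => hB i _ (insertNth_mem_cube ht hy)
  calc ‖flux G a h‖ ≤ ∑ i : Fin (n + 1), (B * h ^ n + B * h ^ n) := by
        refine (norm_sum_le _ _).trans (Finset.sum_le_sum fun i _ => (norm_sub_le _ _).trans ?_)
        exact add_le_add (key i _ ⟨by linarith, le_rfl⟩) (key i _ ⟨le_rfl, by linarith⟩)
    _ = _ := by simp; ring

theorem integral_cube_subdivide {k : ℕ} {f : (Fin n → ℝ) → E} {b : Fin n → ℝ} {δ : ℝ}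
    (hδ : 0 < δ) (hf : IntegrableOn f (cube b (k * δ))) :
    ∫ y in cube b (k * δ), f y =
      ∑ r : Fin n → Fin k, ∫ y in cube (fun j => b j + δ * (r j : ℕ)) δ, f y := by
  -- Half-open boxes tile without overlap and differ from closed cubes by null sets.
  have hcube : ∀ (a : Fin n → ℝ) (h : ℝ), ∫ y in cube a h, f y =
      ∫ y in Set.pi Set.univ (fun j => Set.Ioc (a j) (a j + h)), f y := fun a h => by
    rw [cube]
    exact (setIntegral_congr_set Measure.univ_pi_Ioc_ae_eq_Icc).symm
  simp only [hcube]
  have hU : Set.pi Set.univ (fun j => Set.Ioc (b j) (b j + k * δ)) =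
      ⋃ r : Fin n → Fin k, Set.pi Set.univ
        (fun j => Set.Ioc (b j + δ * (r j : ℕ)) (b j + δ * (r j : ℕ) + δ)) := by
    ext x
    simp only [Set.mem_pi, Set.mem_univ, true_imp_iff, Set.mem_iUnion, Set.mem_Ioc]
    constructor
    · intro hx
      have : ∀ j, ∃ r : Fin k, b j + δ * (r : ℕ) < x j ∧ x j ≤ b j + δ * (r : ℕ) + δ := by
        intro j
        have h0 : 0 < (x j - b j) / δ := div_pos (by linarith [(hx j).1]) hδ
        -- The boxes are open on the left, so the index is the ceiling minus one, not the floor.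
        obtain ⟨c, hc⟩ : ∃ c, ⌈(x j - b j) / δ⌉₊ = c + 1 :=
          Nat.exists_eq_succ_of_ne_zero (Nat.ceil_pos.2 h0).ne'
        have h1 : (x j - b j) / δ ≤ c + 1 := by
          have := Nat.le_ceil ((x j - b j) / δ); rw [hc] at this; exact_mod_cast this
        have h2 : (c : ℝ) < (x j - b j) / δ := Nat.lt_ceil.1 (by omega)
        have h3 : (x j - b j) / δ ≤ k := by
          rw [div_le_iff₀ hδ]; linarith [(hx j).2]
        rw [div_le_iff₀ hδ] at h1
        have hck : c < k := by exact_mod_cast h2.trans_le h3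
        rw [lt_div_iff₀ hδ] at h2
        exact ⟨⟨c, hck⟩, by simp only; linarith, by simp only; linarith⟩
      choose r hr using this
      exact ⟨r, hr⟩
    · rintro ⟨r, hr⟩ j
      have h1 : ((r j : ℕ) : ℝ) + 1 ≤ k := by exact_mod_cast (r j).2
      have h2 := mul_le_mul_of_nonneg_left h1 hδ.le
      have h3 : 0 ≤ δ * ((r j : ℕ) : ℝ) := by positivity
      exact ⟨by linarith [(hr j).1], by linarith [(hr j).2]⟩
  rw [hU, integral_iUnion_fintype (fun r => MeasurableSet.univ_pi fun j => measurableSet_Ioc)]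
  · intro r r' hne
    refine Set.disjoint_left.2 fun x hx hx' => hne ?_
    simp only [Set.mem_pi, Set.mem_univ, true_imp_iff, Set.mem_Ioc] at hx hx'
    have aux : ∀ p q : ℕ, ∀ c t : ℝ, c + δ * p < t → t ≤ c + δ * q + δ → p ≤ q := by
      intro p q c t h1 h2
      have : δ * (p : ℝ) < δ * ((q : ℝ) + 1) := by linarith
      have := lt_of_mul_lt_mul_left this hδ.le
      exact Nat.lt_succ_iff.1 (by exact_mod_cast this)
    funext j
    exact Fin.ext (le_antisymm (aux _ _ _ _ (hx j).1 (hx' j).2) (aux _ _ _ _ (hx' j).1 (hx j).2))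
  · intro r
    refine hf.mono_set ?_
    refine (Set.subset_iUnion _ r).trans (hU.symm.subset.trans ?_)
    rw [cube, ← Set.pi_univ_Icc]
    exact Set.pi_mono fun j _ => Set.Ioc_subset_Icc_self

theorem subcube_subset {N k : ℕ} (a : Fin N → ℝ) {δ : ℝ} (hδ : 0 ≤ δ) (s : Fin N → Fin k) :
    cube (fun j => a j + δ * (s j : ℕ)) δ ⊆ cube a (k * δ) := by
  intro x hx
  rw [mem_cube] at hx ⊢
  intro j
  have h1 : ((s j : ℕ) : ℝ) + 1 ≤ k := by exact_mod_cast (s j).2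
  have h2 := mul_le_mul_of_nonneg_left h1 hδ
  have h3 : 0 ≤ δ * ((s j : ℕ) : ℝ) := by positivity
  exact ⟨by linarith [(hx j).1], by linarith [(hx j).2]⟩

/-- The flux is additive under the subdivision of a cube into `k ^ (n + 1)` equal cubes. -/
theorem flux_subdivide {k : ℕ} {G : Fin (n + 1) → (Fin (n + 1) → ℝ) → E} {a : Fin (n + 1) → ℝ}
    {δ : ℝ} (hδ : 0 < δ) (hG : ∀ i, ContinuousOn (G i) (cube a (k * δ))) :
    flux G a (k * δ) =
      ∑ s : Fin (n + 1) → Fin k, flux G (fun j => a j + δ * (s j : ℕ)) δ := by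
  simp only [flux]
  rw [Finset.sum_comm]
  refine Finset.sum_congr rfl fun i _ => ?_
  -- `I t` is the integral over the whole slice `x_i = a_i + δ t`. Layer `t` of small cubes
  -- contributes `I (t + 1) - I t`, and the layers telescope.
  let I : ℕ → E := fun t => ∫ y in cube (fun j => a (i.succAbove j)) (k * δ),
    G i (Fin.insertNth (α := fun _ => ℝ) i (a i + δ * t) y)
  have hI : ∀ t ≤ k, I t = ∑ r : Fin n → Fin k,
      ∫ y in cube (fun j => a (i.succAbove j) + δ * (r j : ℕ)) δ,
        G i (Fin.insertNth (α := fun _ => ℝ) i (a i + δ * t) y) := by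
    intro t ht
    refine integral_cube_subdivide hδ ?_
    refine (continuousOn_comp_insertNth (hG i) ⟨?_, ?_⟩).integrableOn_compact (isCompact_cube _ _)
    · have : 0 ≤ δ * (t : ℝ) := by positivity
      linarith
    · have : (t : ℝ) ≤ k := by exact_mod_cast ht
      nlinarith
  rw [← (Fin.insertNthEquiv (fun _ => Fin k) i).sum_comp, Fintype.sum_prod_type]
  have hstep : ∀ t : Fin k, (∑ r : Fin n → Fin k,
      ((∫ y in cube (fun j => a (i.succAbove j) +
            δ * ((Fin.insertNthEquiv (fun _ => Fin k) i (t, r) (i.succAbove j) : Fin k) : ℕ)) δ,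
          G i (Fin.insertNth (α := fun _ => ℝ) i
            (a i + δ * ((Fin.insertNthEquiv (fun _ => Fin k) i (t, r) i : Fin k) : ℕ) + δ) y)) -
        ∫ y in cube (fun j => a (i.succAbove j) +
            δ * ((Fin.insertNthEquiv (fun _ => Fin k) i (t, r) (i.succAbove j) : Fin k) : ℕ)) δ,
          G i (Fin.insertNth (α := fun _ => ℝ) i
            (a i + δ * ((Fin.insertNthEquiv (fun _ => Fin k) i (t, r) i : Fin k) : ℕ)) y))) =
      I (t + 1) - I t := by
    intro t
    rw [hI _ t.2, hI _ t.2.le, ← Finset.sum_sub_distrib]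
    refine Finset.sum_congr rfl fun r _ => ?_
    simp only [Fin.insertNthEquiv_apply, Fin.insertNth_apply_same, Fin.insertNth_apply_succAbove]
    congr 4
    push_cast; ring_nf
  rw [Finset.sum_congr rfl fun t _ => hstep t,
    Fin.sum_univ_eq_sum_range (fun t => I (t + 1) - I t) k, Finset.sum_range_sub]
  simp only [I]
  congr 4
  · ring_nf
  · simp

/-- A property of cubes holds if it is inherited from the `2 ^ N` halves and holds for all small
cubes around each point. -/
theorem cube_induction {N : ℕ} {P : (Fin N → ℝ) → ℝ → Prop} {a₀ : Fin N → ℝ} {h₀ : ℝ}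
    (hh₀ : 0 < h₀)
    (hind : ∀ a h, 0 < h → cube a h ⊆ cube a₀ h₀ →
      (∀ s : Fin N → Fin 2, P (fun j => a j + h / 2 * (s j : ℕ)) (h / 2)) → P a h)
    (hloc : ∀ x ∈ cube a₀ h₀, ∃ d > 0, ∀ a h, 0 < h → h < d → x ∈ cube a h →
      cube a h ⊆ cube a₀ h₀ → P a h) : P a₀ h₀ := by
  by_contra hP
  let T := {c : (Fin N → ℝ) × ℝ // 0 < c.2 ∧ cube c.1 c.2 ⊆ cube a₀ h₀ ∧ ¬ P c.1 c.2}
  -- A counterexample has a half that is again a counterexample; the nested halves shrink to a point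
  -- `x` where `hloc` is contradicted.
  have step : ∀ c : T, ∃ c' : T, c'.1.2 = c.1.2 / 2 ∧ cube c'.1.1 c'.1.2 ⊆ cube c.1.1 c.1.2 := by
    rintro ⟨⟨a, h⟩, hh, hsub, hn⟩
    simp only at hh hsub hn
    obtain ⟨s, hs⟩ : ∃ s : Fin N → Fin 2, ¬ P (fun j => a j + h / 2 * (s j : ℕ)) (h / 2) := by
      by_contra! hcon
      exact hn (hind a h hh hsub hcon)
    have hsub' : cube (fun j => a j + h / 2 * (s j : ℕ)) (h / 2) ⊆ cube a h := by
      have := subcube_subset a (half_pos hh).le s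
      rwa [Nat.cast_two, mul_div_cancel₀ h two_ne_zero] at this
    exact ⟨⟨(_, h / 2), half_pos hh, hsub'.trans hsub, hs⟩, rfl, hsub'⟩
  choose f hf1 hf2 using step
  let c : ℕ → T := fun k => f^[k] ⟨(a₀, h₀), hh₀, subset_rfl, hP⟩
  have hc : ∀ k, c (k + 1) = f (c k) := fun k => Function.iterate_succ_apply' f k _
  have hside : ∀ k, (c k).1.2 = h₀ / 2 ^ k := by
    intro k
    induction k with
    | zero => simp [c]
    | succ k ih => rw [hc, hf1, ih, pow_succ, div_div]
  have hne : ∀ k, (cube (c k).1.1 (c k).1.2).Nonempty := fun k =>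
    ⟨(c k).1.1, mem_cube.2 fun i => ⟨le_rfl, by linarith [(c k).2.1]⟩⟩
  obtain ⟨x, hx⟩ := IsCompact.nonempty_iInter_of_sequence_nonempty_isCompact_isClosed
    (fun k => cube (c k).1.1 (c k).1.2) (fun k => by rw [hc]; exact hf2 _) hne
    (isCompact_cube _ _) fun k => (isCompact_cube _ _).isClosed
  rw [Set.mem_iInter] at hx
  obtain ⟨d, hd, hloc⟩ := hloc x ((c 0).2.2.1 (hx 0))
  have hlim : Tendsto (fun k : ℕ => h₀ / 2 ^ k) atTop (𝓝 0) :=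
    tendsto_const_nhds.div_atTop (tendsto_pow_atTop_atTop_of_one_lt one_lt_two)
  obtain ⟨k, hk⟩ := (hlim.eventually (gt_mem_nhds hd)).exists
  exact (c k).2.2.2 (hloc _ _ (c k).2.1 (by rwa [hside]) (hx k) (c k).2.2.1)

theorem flux_halves {G : Fin (n + 1) → (Fin (n + 1) → ℝ) → E} {a : Fin (n + 1) → ℝ} {h : ℝ}
    (hh : 0 < h) (hG : ∀ i, ContinuousOn (G i) (cube a h)) :
    flux G a h = ∑ s : Fin (n + 1) → Fin 2, flux G (fun j => a j + h / 2 * (s j : ℕ)) (h / 2) := by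
  have e : ((2 : ℕ) : ℝ) * (h / 2) = h := by push_cast; ring
  have := flux_subdivide (k := 2) (a := a) (G := G) (half_pos hh) (by rwa [e])
  rwa [e] at this

/-- A flux that vanishes through all small cubes around each point vanishes. -/
theorem flux_eq_zero_of_locally {G : Fin (n + 1) → (Fin (n + 1) → ℝ) → E}
    {a : Fin (n + 1) → ℝ} {h : ℝ} (hh : 0 < h) (hG : ∀ i, ContinuousOn (G i) (cube a h))
    (hloc : ∀ x ∈ cube a h, ∃ d > 0, ∀ a' h', 0 < h' → h' < d → x ∈ cube a' h' →
      cube a' h' ⊆ cube a h → flux G a' h' = 0) : flux G a h = 0 := by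
  refine cube_induction (P := fun a h => flux G a h = 0) hh (fun a' h' hh' hsub hs => ?_) hloc
  rw [flux_halves hh' fun i => (hG i).mono hsub]
  exact Finset.sum_eq_zero fun s _ => hs s

/-- A flux whose density vanishes at each point vanishes. -/
theorem flux_eq_zero_of_density {G : Fin (n + 1) → (Fin (n + 1) → ℝ) → E}
    {a : Fin (n + 1) → ℝ} {h : ℝ} (hh : 0 < h) (hG : ∀ i, ContinuousOn (G i) (cube a h))
    (hloc : ∀ x ∈ cube a h, ∀ ε > 0, ∃ d > 0, ∀ a' h', 0 < h' → h' < d → x ∈ cube a' h' →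
      cube a' h' ⊆ cube a h → ‖flux G a' h'‖ ≤ ε * h' ^ (n + 1)) : flux G a h = 0 := by
  have key : ∀ ε > 0, ‖flux G a h‖ ≤ ε * h ^ (n + 1) := by
    intro ε hε
    refine cube_induction (P := fun a h => ‖flux G a h‖ ≤ ε * h ^ (n + 1)) hh
      (fun a' h' hh' hsub hs => ?_) fun x hx => hloc x hx ε hε
    rw [flux_halves hh' fun i => (hG i).mono hsub]
    -- There are `2 ^ (n + 1)` halves with bound `ε * (h' / 2) ^ (n + 1)` each, so nothing is lost
    -- in adding up.
    refine (norm_sum_le_of_le _ fun s _ => hs s).trans_eq ?_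
    simp only [Finset.sum_const, Finset.card_univ, Fintype.card_fun, Fintype.card_fin, nsmul_eq_mul]
    push_cast
    rw [div_pow]; field_simp
  refine norm_le_zero_iff.1 (le_of_forall_pos_le_add fun ε hε => ?_)
  have := key (ε / h ^ (n + 1)) (by positivity)
  rw [div_mul_cancel₀ _ (by positivity)] at this
  simpa using this

theorem tendsto_integral_face {g : (Fin (n + 1) → ℝ) → E}
    (hg : ContinuousOn g (unitCube (n + 1))) (i : Fin (n + 1)) {T : ℝ → ℝ} {t : ℝ}
    (hT : Tendsto T (𝓝[>] 0) (𝓝 t)) (hT' : ∀ᶠ δ in 𝓝[>] (0 : ℝ), 0 ≤ T δ ∧ T δ ≤ 1)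
    (ht : 0 ≤ t ∧ t ≤ 1) :
    Tendsto (fun δ : ℝ => ∫ y in cube (fun _ => δ) (1 - 2 * δ),
        g (Fin.insertNth (α := fun _ => ℝ) i (T δ) y)) (𝓝[>] 0)
      (𝓝 (∫ y in cube (0 : Fin n → ℝ) 1, g (Fin.insertNth (α := fun _ => ℝ) i t y))) := by
  have hmeas : ∀ (a : Fin n → ℝ) (h : ℝ), MeasurableSet (cube a h) := fun a h =>
    (isCompact_cube a h).measurableSet
  -- Indicators turn the moving domain into a fixed one, for dominated convergence. Pointwise
  -- convergence is proved off the boundary of the face, a null set.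
  simp only [← integral_indicator (hmeas _ _)]
  rw [unitCube_eq_cube] at hg
  obtain ⟨B, hB⟩ := (isCompact_cube _ _).exists_bound_of_continuousOn hg
  have hB0 : 0 ≤ B := (norm_nonneg _).trans
    (hB 0 (mem_cube.2 fun j => ⟨le_rfl, by simp⟩))
  have hsub : ∀ δ : ℝ, 0 < δ → cube (fun _ : Fin n => δ) (1 - 2 * δ) ⊆ cube 0 1 := by
    intro δ hδ y hy
    rw [mem_cube] at hy ⊢
    intro j
    have := hy j
    simp only [Pi.zero_apply]
    constructor <;> linarith
  have hcont : ∀ s : ℝ, 0 ≤ s ∧ s ≤ 1 → ContinuousOn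
      (fun y : Fin n → ℝ => g (Fin.insertNth (α := fun _ => ℝ) i s y)) (cube 0 1) := fun s hs =>
    continuousOn_comp_insertNth hg (by simpa using hs)
  have hpos : ∀ᶠ δ in 𝓝[>] (0 : ℝ), 0 < δ := self_mem_nhdsWithin
  refine tendsto_integral_filter_of_dominated_convergence
    ((cube (0 : Fin n → ℝ) 1).indicator fun _ => B) ?_ ?_ ?_ ?_
  · filter_upwards [hT', hpos] with δ h1 h2
    rw [aestronglyMeasurable_indicator_iff (hmeas _ _)]
    exact ((hcont _ h1).mono (hsub δ h2)).aestronglyMeasurable (hmeas _ _)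
  · filter_upwards [hT', hpos] with δ h1 h2
    refine Eventually.of_forall fun y => ?_
    by_cases hy : y ∈ cube (fun _ : Fin n => δ) (1 - 2 * δ)
    · rw [Set.indicator_of_mem hy, Set.indicator_of_mem (hsub δ h2 hy)]
      exact hB _ (insertNth_mem_cube (by simpa using h1) (hsub δ h2 hy))
    · rw [Set.indicator_of_notMem hy, norm_zero]
      exact Set.indicator_nonneg (fun _ _ => hB0) _
  · rw [integrable_indicator_iff (hmeas _ _)]
    exact integrableOn_const (volume_cube_lt_top _ _).ne
  · have hae : (Set.pi Set.univ fun j : Fin n => Set.Ioo ((0 : Fin n → ℝ) j) (0 + 1))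
        =ᵐ[volume] cube (0 : Fin n → ℝ) 1 := Measure.univ_pi_Ioo_ae_eq_Icc
    filter_upwards [hae.mem_iff] with y hy
    by_cases hy1 : y ∈ cube (0 : Fin n → ℝ) 1
    · rw [Set.indicator_of_mem hy1]
      have hy2 := hy.2 hy1
      simp only [Set.mem_pi, Set.mem_univ, true_imp_iff, Set.mem_Ioo, Pi.zero_apply,
        zero_add] at hy2
      have hin : ∀ᶠ δ in 𝓝[>] (0 : ℝ), y ∈ cube (fun _ : Fin n => δ) (1 - 2 * δ) := by
        simp only [mem_cube]
        refine eventually_all.2 fun j => nhdsWithin_le_nhds ?_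
        filter_upwards [gt_mem_nhds (hy2 j).1, gt_mem_nhds (sub_pos.2 (hy2 j).2)] with δ h1 h2
        constructor <;> linarith
      have hlim : Tendsto (fun δ => g (Fin.insertNth (α := fun _ => ℝ) i (T δ) y)) (𝓝[>] 0)
          (𝓝 (g (Fin.insertNth (α := fun _ => ℝ) i t y))) := by
        refine (hg _ (insertNth_mem_cube (by simpa using ht) hy1)).tendsto.comp
          (tendsto_nhdsWithin_iff.2 ⟨?_, ?_⟩)
        · exact Tendsto.finInsertNth i hT tendsto_const_nhds
        · filter_upwards [hT'] with δ h1
          exact insertNth_mem_cube (by simpa using h1) hy1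
      refine hlim.congr' ?_
      filter_upwards [hin] with δ h1
      rw [Set.indicator_of_mem h1]
    · rw [Set.indicator_of_notMem hy1]
      refine tendsto_const_nhds.congr' ?_
      filter_upwards [hpos] with δ h2
      rw [Set.indicator_of_notMem fun h => hy1 (hsub δ h2 h)]

/-- The flux through the boundary of the unit cube vanishes if it vanishes for the cubes
`[δ, 1 - δ] ^ (n + 1)`. -/
theorem flux_unitCube_eq_zero {G : Fin (n + 1) → (Fin (n + 1) → ℝ) → E}
    (hG : ∀ i, ContinuousOn (G i) (unitCube (n + 1)))
    (h0 : ∀ δ : ℝ, 0 < δ → δ < 1 / 2 → flux G (fun _ => δ) (1 - 2 * δ) = 0) :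
    flux G 0 1 = 0 := by
  have hid : Tendsto (fun δ : ℝ => δ) (𝓝[>] 0) (𝓝 0) := nhdsWithin_le_nhds
  have hsm : ∀ᶠ δ in 𝓝[>] (0 : ℝ), 0 < δ ∧ δ < 1 / 2 :=
    Ioo_mem_nhdsGT (by norm_num)
  have hlim : Tendsto (fun δ : ℝ => flux G (fun _ => δ) (1 - 2 * δ)) (𝓝[>] 0)
      (𝓝 (flux G 0 1)) := by
    refine tendsto_finsetSum _ fun i _ => Tendsto.sub ?_ ?_
    · refine tendsto_integral_face (hG i) i (T := fun δ => δ + (1 - 2 * δ)) ?_ ?_ (by simp)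
      · have := hid.add ((hid.const_mul 2).const_sub 1)
        simpa using this
      · filter_upwards [hsm] with δ h; constructor <;> linarith
    · refine tendsto_integral_face (hG i) i (T := fun δ => δ) (by simpa using hid) ?_ (by simp)
      filter_upwards [hsm] with δ h; constructor <;> linarith
  refine tendsto_nhds_unique (hlim.congr' ?_) tendsto_const_nhds
  filter_upwards [hsm] with δ h
  exact h0 δ h.1 h.2

end Flux

/-! ### Directed measure of a boundary -/

section Stokes

variable {n : ℕ} {F E : Type*} [NormedAddCommGroup F] [NormedSpace ℝ F]
  [NormedAddCommGroup E] [NormedSpace ℝ E]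

/-- The pullback of a constant form by a `C^2` map has no flux through the boundary of a cube. -/
theorem flux_pullback_of_contDiff_two (ω : F [⋀^Fin n]→L[ℝ] E) {ψ : (Fin (n + 1) → ℝ) → F}
    (hψ : ContDiff ℝ 2 ψ) (a : Fin (n + 1) → ℝ) {h : ℝ} (hh : 0 ≤ h) :
    flux (fun i x => (-1 : ℝ) ^ (i : ℕ) •
      ω fun j => fderiv ℝ ψ x (Pi.single (i.succAbove j) 1)) a h = 0 := by
  let η : (Fin (n + 1) → ℝ) → (Fin (n + 1) → ℝ) [⋀^Fin n]→L[ℝ] E :=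
    fun x => ω.compContinuousLinearMap (fderiv ℝ ψ x)
  have hdψ : Differentiable ℝ (fderiv ℝ ψ) :=
    (hψ.fderiv_right (m := 1) (by norm_num)).differentiable one_ne_zero
  have hη : Differentiable ℝ η := fun x =>
    (DifferentiableAt.continuousAlternatingMapCompContinuousLinearMap
      (differentiableAt_const ω) (hdψ x))
  -- The exterior derivative commutes with pullback by a `C^2` map, and a constant form is closed.
  have hd : ∀ x, extDeriv η x = 0 := by
    intro x
    have := extDeriv_pullback (ω := fun _ : F => ω) (f := ψ) (x := x)
      (differentiableAt_const _) hψ.contDiffAt (by simp)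
    rw [show η = fun x => ω.compContinuousLinearMap (fderiv ℝ ψ x) from rfl, this]
    ext v
    simp [extDeriv, ContinuousAlternatingMap.alternatizeUncurryFin_apply]
  let e : Fin (n + 1) → Fin (n + 1) → ℝ := fun j => Pi.single j 1
  let f : (Fin (n + 1) → ℝ) → Fin (n + 1) → E :=
    fun x i => (-1 : ℝ) ^ (i : ℕ) • η x (i.removeNth e)
  have hfi : ∀ i x, HasFDerivAt (fun x => f x i)
      ((-1 : ℝ) ^ (i : ℕ) • fderiv ℝ (fun x => η x (i.removeNth e)) x) x := fun i x =>
    ((hη x).continuousAlternatingMap_apply_const _).hasFDerivAt.const_smul _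
  have hf : ∀ x, HasFDerivAt f (ContinuousLinearMap.pi fun i : Fin (n + 1) =>
      (-1 : ℝ) ^ (i : ℕ) • fderiv ℝ (fun x => η x (i.removeNth e)) x) x := fun x =>
    hasFDerivAt_pi.2 fun i => hfi i x
  -- The divergence of `f` is the value of `extDeriv η` on the standard basis.
  have hdiv : ∀ x, ∑ i, (ContinuousLinearMap.pi fun i : Fin (n + 1) =>
      (-1 : ℝ) ^ (i : ℕ) • fderiv ℝ (fun x => η x (i.removeNth e)) x) (Pi.single i 1) i = 0 := by
    intro x
    have := extDeriv_apply (hη x) e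
    rw [hd] at this
    simp only [ContinuousAlternatingMap.coe_zero, Pi.zero_apply] at this
    rw [this]
    refine Finset.sum_congr rfl fun i _ => ?_
    rcases Nat.even_or_odd (i : ℕ) with hi | hi <;>
    simp [e, hi.neg_one_pow]
  have key := integral_divergence_of_hasFDerivAt_off_countable a (fun i => a i + h)
    (fun i => by linarith) f _ ∅ Set.countable_empty
    (fun x _ => (hf x).continuousAt.continuousWithinAt) (fun x _ => hf x)
    (by simp only [hdiv]; exact integrableOn_zero)
  simp only [hdiv, integral_zero] at key
  exact key.symm

/-- The pullback of a constant form by a compactly supported `C^1` map has no flux through the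
boundary of a cube. -/
theorem flux_pullback_of_hasCompactSupport [CompleteSpace F] (ω : F [⋀^Fin n]→L[ℝ] E)
    {g : (Fin (n + 1) → ℝ) → F} (hg : ContDiff ℝ 1 g) (hc : HasCompactSupport g)
    (a : Fin (n + 1) → ℝ) {h : ℝ} (hh : 0 ≤ h) :
    flux (fun i x => (-1 : ℝ) ^ (i : ℕ) •
      ω fun j => fderiv ℝ g x (Pi.single (i.succAbove j) 1)) a h = 0 := by
  let ρ : ℕ → ContDiffBump (0 : Fin (n + 1) → ℝ) := fun k =>
    ⟨1 / (2 * ((k : ℝ) + 1)), 1 / ((k : ℝ) + 1), by positivity, by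
      apply one_div_lt_one_div_of_lt <;> nlinarith [Nat.cast_nonneg (α := ℝ) k]⟩
  have hρ : Tendsto (fun k => (ρ k).rOut) atTop (𝓝 0) := tendsto_one_div_add_atTop_nhds_zero_nat
  -- The mollified maps are `C^2`, and their derivatives are the mollifications of that of `g`: they
  -- converge pointwise and stay uniformly bounded, so the face integrals converge.
  let ψ : ℕ → (Fin (n + 1) → ℝ) → F := fun k =>
    MeasureTheory.convolution ((ρ k).normed volume) g (ContinuousLinearMap.lsmul ℝ ℝ) volume
  have hψ : ∀ k, ContDiff ℝ 2 (ψ k) := fun k =>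
    (ρ k).hasCompactSupport_normed.contDiff_convolution_left (n := 2) _ (ρ k).contDiff_normed
      hg.continuous.locallyIntegrable
  have hdψ : ∀ k x, fderiv ℝ (ψ k) x = MeasureTheory.convolution ((ρ k).normed volume)
      (fderiv ℝ g) (ContinuousLinearMap.lsmul ℝ ℝ) volume x := by
    intro k x
    rw [(hc.hasFDerivAt_convolution_right (ContinuousLinearMap.lsmul ℝ ℝ)
      (ρ k).continuous_normed.locallyIntegrable hg x).fderiv]
    congr 1
  have hdg : Continuous (fderiv ℝ g) := hg.continuous_fderiv one_ne_zero
  have hpt : ∀ x, Tendsto (fun k => fderiv ℝ (ψ k) x) atTop (𝓝 (fderiv ℝ g x)) := by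
    intro x
    simp only [hdψ]
    exact ContDiffBump.convolution_tendsto_right_of_continuous hρ hdg x
  obtain ⟨C, hC⟩ := (hc.fderiv ℝ).exists_bound_of_continuous hdg
  -- `C` bounds the derivative of `g`, and its oscillation `2 * C` bounds the change made by
  -- averaging.
  have hbd : ∀ k x, ‖fderiv ℝ (ψ k) x‖ ≤ 3 * C := by
    intro k x
    have h1 : dist (fderiv ℝ (ψ k) x) (fderiv ℝ g x) ≤ 2 * C := by
      rw [hdψ]
      refine ContDiffBump.dist_normed_convolution_le hdg.aestronglyMeasurable fun y _ => ?_
      rw [dist_eq_norm]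
      exact (norm_sub_le _ _).trans (by linarith [hC x, hC y])
    rw [dist_eq_norm] at h1
    have := norm_le_norm_add_norm_sub' (fderiv ℝ (ψ k) x) (fderiv ℝ g x)
    linarith [hC x]
  have hint : ∀ (i : Fin (n + 1)) (t : ℝ), Tendsto (fun k =>
      ∫ y in cube (fun j => a (i.succAbove j)) h, (-1 : ℝ) ^ (i : ℕ) •
        ω fun j => fderiv ℝ (ψ k) (Fin.insertNth (α := fun _ => ℝ) i t y)
          (Pi.single (i.succAbove j) 1)) atTop
      (𝓝 (∫ y in cube (fun j => a (i.succAbove j)) h, (-1 : ℝ) ^ (i : ℕ) •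
        ω fun j => fderiv ℝ g (Fin.insertNth (α := fun _ => ℝ) i t y)
          (Pi.single (i.succAbove j) 1))) := by
    intro i t
    refine tendsto_integral_of_dominated_convergence (fun _ => ‖ω‖ * (3 * C) ^ n) ?_ ?_ ?_ ?_
    · intro k
      have h1 : Continuous fun y : Fin n → ℝ =>
          fderiv ℝ (ψ k) (Fin.insertNth (α := fun _ => ℝ) i t y) :=
        ((hψ k).continuous_fderiv two_ne_zero).comp (continuous_insertNth_const i t)
      exact (((ω.cont.comp (continuous_pi fun j =>
        h1.clm_apply continuous_const))).const_smul _).aestronglyMeasurable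
    · exact integrableOn_const (volume_cube_lt_top _ _).ne
    · intro k
      refine Eventually.of_forall fun y => ?_
      rw [norm_smul, norm_pow, norm_neg, norm_one, one_pow, one_mul]
      refine (ω.le_opNorm _).trans (mul_le_mul_of_nonneg_left ?_ (norm_nonneg _))
      refine (Finset.prod_le_prod (fun _ _ => norm_nonneg _) (g := fun _ => 3 * C)
        fun j _ => ?_).trans_eq (by simp)
      refine (ContinuousLinearMap.le_opNorm _ _).trans ?_
      simpa [Pi.norm_single] using hbd k _
    · refine Eventually.of_forall fun y => Tendsto.const_smul ?_ _
      refine (ω.cont.tendsto _).comp (tendsto_pi_nhds.2 fun j => ?_)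
      exact ((ContinuousLinearMap.apply ℝ F (Pi.single (i.succAbove j) (1 : ℝ))).continuous.tendsto
        _).comp (hpt _)
  have hlim := tendsto_finsetSum Finset.univ fun (i : Fin (n + 1)) _ =>
    (hint i (a i + h)).sub (hint i (a i))
  refine tendsto_nhds_unique hlim (tendsto_const_nhds.congr fun k => ?_)
  exact (flux_pullback_of_contDiff_two ω (hψ k) a hh).symm

end Stokes

/-! ### Localization to singular cubes -/

theorem flux_congr {n : ℕ} {E : Type*} [NormedAddCommGroup E] [NormedSpace ℝ E]
    {G G' : Fin (n + 1) → (Fin (n + 1) → ℝ) → E} {a : Fin (n + 1) → ℝ} {h : ℝ} (hh : 0 ≤ h)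
    (hGG : ∀ i, ∀ x ∈ cube a h, G i x = G' i x) : flux G a h = flux G' a h := by
  refine Finset.sum_congr rfl fun i _ => congrArg₂ _ ?_ ?_ <;>
  · refine setIntegral_congr_fun (isCompact_cube _ _).measurableSet fun y hy => hGG _ _ ?_
    exact insertNth_mem_cube (by constructor <;> linarith) hy

theorem openUnitCube_eq (k : ℕ) : openUnitCube k = Set.pi Set.univ fun _ => Set.Ioo (0 : ℝ) 1 := by
  ext x; simp [openUnitCube]

theorem isOpen_openUnitCube (k : ℕ) : IsOpen (openUnitCube k) := by
  rw [openUnitCube_eq]; exact isOpen_set_pi Set.finite_univ fun _ _ => isOpen_Ioo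

theorem openUnitCube_subset (k : ℕ) : openUnitCube k ⊆ unitCube k := fun _ hx =>
  ⟨fun i => (hx i).1.le, fun i => (hx i).2.le⟩

theorem unitCube_mem_nhds {k : ℕ} {x : Fin k → ℝ} (hx : x ∈ openUnitCube k) : unitCube k ∈ 𝓝 x :=
  mem_of_superset ((isOpen_openUnitCube k).mem_nhds hx) (openUnitCube_subset k)

theorem convex_unitCube (k : ℕ) : Convex ℝ (unitCube k) := convex_Icc _ _

theorem isCompact_unitCube (k : ℕ) : IsCompact (unitCube k) := isCompact_Icc

theorem uniqueDiffOn_unitCube (k : ℕ) : UniqueDiffOn ℝ (unitCube k) := by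
  refine uniqueDiffOn_convex (convex_unitCube k) ⟨fun _ => 1 / 2, ?_⟩
  rw [mem_interior_iff_mem_nhds]
  exact unitCube_mem_nhds fun i => by norm_num

/-- The pullback of a constant form by a `C^1` map has no flux through the boundary of a cube. -/
theorem flux_pullback {n m : ℕ} {E : Type*} [NormedAddCommGroup E] [NormedSpace ℝ E]
    (ω : Space m [⋀^Fin n]→L[ℝ] E) {φ : (Fin (n + 1) → ℝ) → Space m}
    (hφ : ContDiffOn ℝ 1 φ (unitCube (n + 1))) {a : Fin (n + 1) → ℝ} {h : ℝ} (hh : 0 < h)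
    (hsub : cube a h ⊆ openUnitCube (n + 1)) :
    flux (fun i x => (-1 : ℝ) ^ (i : ℕ) • ω fun j => partialDeriv φ x (i.succAbove j)) a h = 0 := by
  have hcont : ContinuousOn (fderivWithin ℝ φ (unitCube (n + 1))) (unitCube (n + 1)) :=
    hφ.continuousOn_fderivWithin (uniqueDiffOn_unitCube _) le_rfl
  refine flux_eq_zero_of_locally hh (fun i => ?_) fun x hx => ?_
  · refine ContinuousOn.const_smul (ω.cont.comp_continuousOn (continuousOn_pi.2 fun j => ?_)) _
    exact (hcont.mono (hsub.trans (openUnitCube_subset _))).clm_apply continuousOn_const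
  · obtain ⟨r, hr, hball⟩ := Metric.isOpen_iff.1 (isOpen_openUnitCube (n + 1)) x (hsub hx)
    -- The cutoff makes `g` globally `C^1` with compact support, while `g = φ` on the sup-norm ball
    -- of radius `r / 4`, which contains every cube through `x` of side less than `r / 4`.
    let χ : ContDiffBump x := ⟨r / 4, r / 2, by positivity, by linarith⟩
    let g : (Fin (n + 1) → ℝ) → Space m := fun y => χ y • φ y
    have hsupp : tsupport g ⊆ openUnitCube (n + 1) := by
      refine (tsupport_smul_subset_left χ φ).trans ?_
      rw [χ.tsupport_eq]
      exact (Metric.closedBall_subset_ball (show r / 2 < r by linarith)).trans hball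
    have hgc : HasCompactSupport g := χ.hasCompactSupport.smul_right
    have hg : ContDiff ℝ 1 g := by
      refine contDiff_iff_contDiffAt.2 fun y => ?_
      by_cases hy : y ∈ tsupport g
      · exact χ.contDiffAt.smul (hφ.contDiffAt (unitCube_mem_nhds (hsupp hy)))
      · exact contDiffAt_const.congr_of_eventuallyEq (notMem_tsupport_iff_eventuallyEq.1 hy)
    refine ⟨r / 4, by positivity, fun a' h' hh' hlt hx' hsub' => ?_⟩
    rw [← flux_pullback_of_hasCompactSupport ω hg hgc a' hh'.le]
    refine flux_congr hh'.le fun i y hy => ?_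
    have hdist : y ∈ Metric.ball x χ.rIn := by
      rw [Metric.mem_ball]
      change dist y x < r / 4
      refine (dist_pi_lt_iff (by positivity)).2 fun j => ?_
      rw [mem_cube] at hy hx'
      rw [Real.dist_eq, abs_lt]
      constructor <;> linarith [hy j, hx' j]
    have heq : g =ᶠ[𝓝 y] φ := by
      filter_upwards [χ.eventuallyEq_one_of_mem_ball hdist] with z hz
      simp [g, hz]
    simp only [partialDeriv]
    rw [heq.fderiv_eq, fderivWithin_of_mem_nhds (unitCube_mem_nhds (hsub (hsub' hy)))]

/-! ### Local geometry of singular cubes -/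

theorem continuousOn_partialDeriv {k m : ℕ} {φ : (Fin k → ℝ) → Space m}
    (hφ : ContDiffOn ℝ 1 φ (unitCube k)) (j : Fin k) :
    ContinuousOn (fun x => partialDeriv φ x j) (unitCube k) :=
  (hφ.continuousOn_fderivWithin (uniqueDiffOn_unitCube _) le_rfl).clm_apply continuousOn_const

theorem continuousOn_jacobian {k m : ℕ} {φ : (Fin k → ℝ) → Space m}
    (hφ : ContDiffOn ℝ 1 φ (unitCube k)) : ContinuousOn (jacobian φ) (unitCube k) := by
  refine Real.continuous_sqrt.comp_continuousOn
    (Continuous.matrix_det continuous_id |>.comp_continuousOn ?_)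
  refine continuousOn_pi.2 fun i => continuousOn_pi.2 fun j => ?_
  exact (continuousOn_partialDeriv hφ i).inner (𝕜 := ℝ) (continuousOn_partialDeriv hφ j)

theorem exists_lipschitz_bound {k m : ℕ} {φ : (Fin k → ℝ) → Space m}
    (hφ : ContDiffOn ℝ 1 φ (unitCube k)) :
    ∃ L : ℝ, 0 ≤ L ∧ ∀ x ∈ unitCube k, ∀ y ∈ unitCube k, ‖φ x - φ y‖ ≤ L * ‖x - y‖ := by
  obtain ⟨L, hL⟩ := (isCompact_unitCube k).exists_bound_of_continuousOn
    (hφ.continuousOn_fderivWithin (uniqueDiffOn_unitCube _) le_rfl)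
  refine ⟨max L 0, le_max_right _ _, fun x hx y hy => ?_⟩
  exact (convex_unitCube k).norm_image_sub_le_of_norm_fderivWithin_le
    (hφ.differentiableOn one_ne_zero) (fun z hz => (hL z hz).trans (le_max_left _ _)) hy hx

/-- A positive Jacobian makes the differential injective, hence bounded below by some `1 / K`.
Strict differentiability makes the error at most half of that, leaving `l = 1 / (2 * K)`. -/
theorem exists_local_antilipschitz_bound {k m : ℕ} {φ : (Fin k → ℝ) → Space m} {x : Fin k → ℝ}
    (hφ : ContDiffOn ℝ 1 φ (unitCube k)) (hx : x ∈ openUnitCube k) (hJ : 0 < jacobian φ x) :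
    ∃ l > 0, ∃ d > 0, ∀ y ∈ Metric.ball x d, ∀ z ∈ Metric.ball x d,
      l * ‖y - z‖ ≤ ‖φ y - φ z‖ := by
  have hstrict : HasStrictFDerivAt φ (fderiv ℝ φ x) x :=
    (hφ.contDiffAt (unitCube_mem_nhds hx)).hasStrictFDerivAt one_ne_zero
  have hker : LinearMap.ker (fderiv ℝ φ x).toLinearMap = ⊥ := by
    rw [LinearMap.ker_eq_bot']
    intro v hv
    have hli := Fintype.linearIndependent_iff.1 (linearIndependent_partialDeriv hJ) v
    refine funext (hli ?_)
    rw [← hv]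
    have hs := pi_eq_sum_univ' v
    conv_rhs => rw [hs]
    simp only [ContinuousLinearMap.coe_coe, map_sum, map_smul]
    refine Finset.sum_congr rfl fun i _ => ?_
    rw [partialDeriv, fderivWithin_of_mem_nhds (unitCube_mem_nhds hx)]
  obtain ⟨K, hK0, hK⟩ := LinearMap.exists_antilipschitzWith _ hker
  have hK0' : (0 : ℝ) < K := hK0
  have hbound : ∀ v, ‖v‖ ≤ K * ‖fderiv ℝ φ x v‖ := fun v => by
    simpa using hK.le_mul_dist v 0
  have hev := hstrict.isLittleO.def (show (0 : ℝ) < 1 / (2 * K) by positivity)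
  obtain ⟨d, hd, hball⟩ := Metric.eventually_nhds_iff_ball.1 hev
  refine ⟨1 / (2 * K), by positivity, d, hd, fun y hy z hz => ?_⟩
  have h1 := hball (y, z) (by
    rw [← ball_prod_same]; exact ⟨hy, hz⟩)
  simp only at h1
  have h2 := hbound (y - z)
  have h3 : ‖fderiv ℝ φ x (y - z)‖ ≤ ‖φ y - φ z‖ + ‖φ y - φ z - fderiv ℝ φ x (y - z)‖ := by
    have := norm_sub_le (φ y - φ z) (φ y - φ z - fderiv ℝ φ x (y - z))
    simpa using this
  have h4 : ‖y - z‖ / K ≤ ‖fderiv ℝ φ x (y - z)‖ := by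
    rw [div_le_iff₀ hK0']; linarith
  have h5 : ‖y - z‖ / K = 1 / (2 * K) * ‖y - z‖ + 1 / (2 * K) * ‖y - z‖ := by
    field_simp; ring
  linarith

/-! ### Counting the parts that meet the image of a face -/

theorem card_fin_near_le {k D : ℕ} (s : Fin k) :
    (Finset.univ.filter fun t : Fin k => (t : ℕ) ≤ s + D ∧ (s : ℕ) ≤ t + D).card ≤ 2 * D + 1 := by
  calc _ ≤ (Finset.Icc ((s : ℕ) - D) (s + D)).card := by
        refine Finset.card_le_card_of_injOn Fin.val (fun t ht => ?_) Fin.val_injective.injOn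
        simp only [Finset.coe_filter, Finset.mem_univ, true_and, Set.mem_ofPred_eq] at ht
        simp only [Finset.coe_Icc, Set.mem_Icc]
        omega
    _ ≤ 2 * D + 1 := by rw [Nat.card_Icc]; omega

open scoped Classical in
/-- If `φ` is bi-Lipschitz on a cube, then of the `k ^ (n + 1)` equal parts of the cube only
`O(k ^ n)` meet the preimage of a Lipschitz image of the boundary of the unit cube. -/
theorem exists_card_meeting_le {n m : ℕ} {φ ψ : (Fin (n + 1) → ℝ) → Space m}
    {a : Fin (n + 1) → ℝ} {h l L : ℝ} (hh : 0 < h) (hl : 0 < l) (hL : 0 ≤ L)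
    (hφ : ∀ y ∈ cube a h, ∀ z ∈ cube a h, l * ‖y - z‖ ≤ ‖φ y - φ z‖)
    (hψ : ∀ y ∈ unitCube (n + 1), ∀ z ∈ unitCube (n + 1), ‖ψ y - ψ z‖ ≤ L * ‖y - z‖) :
    ∃ C : ℕ, ∀ k : ℕ, 0 < k →
      (Finset.univ.filter fun s : Fin (n + 1) → Fin k =>
        ∃ p ∈ cube (fun j => a j + h / k * (s j : ℕ)) (h / k),
          φ p ∈ ψ '' (unitCube (n + 1) \ openUnitCube (n + 1))).card ≤ C * k ^ n := by
  -- Points of two parts at distance at most `L / (l * k)` force indices to differ by at most `L /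
  -- (l * h) + 1`, in units of the side `h / k`.
  obtain ⟨D, hD⟩ := exists_nat_ge (L / (l * h) + 1)
  refine ⟨(2 * D + 1) ^ (n + 1) * ((n + 1) * (2 * 2 ^ n)), fun k hk => ?_⟩
  have hk' : (0 : ℝ) < k := by exact_mod_cast hk
  have hδ : 0 < h / k := by positivity
  set S := Finset.univ.filter fun s : Fin (n + 1) → Fin k =>
    ∃ p ∈ cube (fun j => a j + h / k * (s j : ℕ)) (h / k),
      φ p ∈ ψ '' (unitCube (n + 1) \ openUnitCube (n + 1))
  have hch : ∀ s : Fin (n + 1) → Fin k, ∃ (p q : Fin (n + 1) → ℝ) (i : Fin (n + 1)) (b : Bool),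
      s ∈ S → p ∈ cube (fun j => a j + h / k * (s j : ℕ)) (h / k) ∧ q ∈ unitCube (n + 1) ∧
        φ p = ψ q ∧ q i = if b then 1 else 0 := by
    intro s
    by_cases hs : s ∈ S
    · obtain ⟨p, hp, q, ⟨hq, hq'⟩, hpq⟩ := (Finset.mem_filter.1 hs).2
      simp only [openUnitCube, Set.mem_ofPred_eq, not_forall, not_and, not_lt] at hq'
      obtain ⟨i, hi⟩ := hq'
      have h0 : 0 ≤ q i := hq.1 i
      have h1 : q i ≤ 1 := hq.2 i
      rcases h0.eq_or_lt with h0 | h0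
      · exact ⟨p, q, i, false, fun _ => ⟨hp, hq, hpq.symm, by simp [← h0]⟩⟩
      · exact ⟨p, q, i, true, fun _ => ⟨hp, hq, hpq.symm, by simp [le_antisymm h1 (hi h0)]⟩⟩
    -- Arbitrary values: only indices in `S` are used.
    · exact ⟨0, 0, 0, true, fun h => absurd h hs⟩
  choose p q i b hpq using hch
  -- The code records the face containing `q s` and its cell of side `1 / k` there. A coordinate
  -- equal to `1` has floor `k`, hence `k + 1` values; the reduction in `Fin.ofNat` changes nothing.
  -- Equal codes bring the `q`, hence the `p`, close together, so at most `(2 * D + 1) ^ (n + 1)`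
  -- parts share a code.
  let code : (Fin (n + 1) → Fin k) → Fin (n + 1) × Bool × (Fin n → Fin (k + 1)) := fun s =>
    (i s, b s, fun j => Fin.ofNat (k + 1) ⌊(k : ℝ) * q s ((i s).succAbove j)⌋₊)
  have hsame : ∀ s ∈ S, ∀ t ∈ S, code s = code t →
      ∀ j, (t j : ℕ) ≤ s j + D ∧ (s j : ℕ) ≤ t j + D := by
    intro s hs t ht hst
    obtain ⟨hps, hqs, hes, his⟩ := hpq s hs
    obtain ⟨hpt, hqt, het, hit⟩ := hpq t ht
    simp only [code, Prod.mk.injEq] at hst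
    obtain ⟨e1, e2, e3⟩ := hst
    have hqd : ‖q s - q t‖ ≤ 1 / k := by
      refine (pi_norm_le_iff_of_nonneg (by positivity)).2 fun j => ?_
      rw [Pi.sub_apply, Real.norm_eq_abs]
      rcases Fin.eq_self_or_eq_succAbove (i s) j with rfl | ⟨j, rfl⟩
      · have : q s (i s) = q t (i s) := by rw [his, e1, hit, e2]
        rw [this, sub_self, abs_zero]; positivity
      · have e4 := congrFun e3 j
        rw [← e1] at e4
        have hfl : ∀ u ∈ unitCube (n + 1),
            ⌊(k : ℝ) * u ((i s).succAbove j)⌋₊ < k + 1 := by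
          intro u hu
          refine Nat.lt_succ_iff.2 ((Nat.floor_le_floor ?_).trans_eq (Nat.floor_natCast k))
          have h1 : u ((i s).succAbove j) ≤ 1 := hu.2 _
          nlinarith
        have e5 := congrArg Fin.val e4
        simp only [Fin.ofNat, Nat.mod_eq_of_lt (hfl _ hqs), Nat.mod_eq_of_lt (hfl _ hqt)] at e5
        have n1 : 0 ≤ (k : ℝ) * q s ((i s).succAbove j) := mul_nonneg hk'.le (hqs.1 _)
        have n2 : 0 ≤ (k : ℝ) * q t ((i s).succAbove j) := mul_nonneg hk'.le (hqt.1 _)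
        have f1 := Nat.floor_le n1
        have f2 := Nat.lt_floor_add_one ((k : ℝ) * q s ((i s).succAbove j))
        have f3 := Nat.floor_le n2
        have f4 := Nat.lt_floor_add_one ((k : ℝ) * q t ((i s).succAbove j))
        rw [e5] at f1 f2
        have habs : |q s ((i s).succAbove j) - q t ((i s).succAbove j)| * k =
            |(k : ℝ) * q s ((i s).succAbove j) - k * q t ((i s).succAbove j)| := by
          rw [← mul_sub, abs_mul, abs_of_pos hk', mul_comm]
        rw [le_div_iff₀ hk', habs, abs_le]
        constructor <;> linarith
    have hsub : ∀ u : Fin (n + 1) → Fin k,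
        cube (fun j => a j + h / k * (u j : ℕ)) (h / k) ⊆ cube a h := by
      intro u
      have := subcube_subset a hδ.le u
      rwa [mul_div_cancel₀ h hk'.ne'] at this
    have hpd : ‖p s - p t‖ ≤ L / (l * k) := by
      have h1 := hφ _ (hsub s hps) _ (hsub t hpt)
      rw [hes, het] at h1
      have h2 := h1.trans ((hψ _ hqs _ hqt).trans (mul_le_mul_of_nonneg_left hqd hL))
      rw [le_div_iff₀ (by positivity)]
      have h3 := mul_le_mul_of_nonneg_right h2 hk'.le
      have h4 : L * (1 / (k : ℝ)) * k = L := by field_simp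
      linarith
    have hreal : ∀ u v : Fin (n + 1) → Fin k, ∀ pu pv : Fin (n + 1) → ℝ,
        pu ∈ cube (fun j => a j + h / k * (u j : ℕ)) (h / k) →
        pv ∈ cube (fun j => a j + h / k * (v j : ℕ)) (h / k) → ‖pu - pv‖ ≤ L / (l * k) →
        ∀ j, (u j : ℕ) ≤ v j + D := by
      intro u v pu pv hu hv hd j
      have h1 := (le_abs_self _).trans ((norm_le_pi_norm (pu - pv) j).trans hd)
      rw [Pi.sub_apply] at h1
      have h2 := (mem_cube.1 hu j).1
      have h3 := (mem_cube.1 hv j).2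
      have h4 : h / k * (u j : ℕ) ≤ h / k * ((v j : ℕ) + (L / (l * h) + 1)) := by
        have : h / k * (L / (l * h)) = L / (l * k) := by field_simp
        rw [mul_add, mul_add, this]; linarith
      have h5 := le_of_mul_le_mul_left h4 hδ
      have h6 : ((u j : ℕ) : ℝ) ≤ (v j : ℕ) + (D : ℝ) := by linarith
      exact_mod_cast h6
    intro j
    exact ⟨hreal t s _ _ hpt hps (by rwa [norm_sub_rev]) j, hreal s t _ _ hps hpt hpd j⟩
  have hfib : ∀ c ∈ (Finset.univ : Finset (Fin (n + 1) × Bool × (Fin n → Fin (k + 1)))),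
      (S.filter fun s => code s = c).card ≤ (2 * D + 1) ^ (n + 1) := by
    intro c _
    rcases (S.filter fun s => code s = c).eq_empty_or_nonempty with he | ⟨s, hs⟩
    · rw [he]; simp
    · rw [Finset.mem_filter] at hs
      calc _ ≤ (Fintype.piFinset fun j => Finset.univ.filter fun t : Fin k =>
              (t : ℕ) ≤ s j + D ∧ (s j : ℕ) ≤ t + D).card := by
            refine Finset.card_le_card fun t ht => ?_
            rw [Finset.mem_filter] at ht
            rw [Fintype.mem_piFinset]
            intro j
            exact Finset.mem_filter.2
              ⟨Finset.mem_univ _, hsame s hs.1 t ht.1 (hs.2.trans ht.2.symm) j⟩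
        _ ≤ ∏ _j : Fin (n + 1), (2 * D + 1) := by
            rw [Fintype.card_piFinset]
            exact Finset.prod_le_prod' fun j _ => card_fin_near_le (s j)
        _ = _ := by simp
  refine (Finset.card_le_mul_card_image_of_maps_to (fun s _ => Finset.mem_univ (code s)) _
    hfib).trans ?_
  rw [mul_assoc]
  refine Nat.mul_le_mul_left _ ?_
  simp only [Finset.card_univ, Fintype.card_prod, Fintype.card_fin, Fintype.card_bool,
    Fintype.card_fun]
  rw [mul_assoc, mul_assoc]
  refine Nat.mul_le_mul_left _ (Nat.mul_le_mul_left _ ?_)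
  -- Since `k > 0`, `k + 1 ≤ 2 * k`; this is the origin of the factor `2 ^ n`.
  rw [← mul_pow]
  exact Nat.pow_le_pow_left (by omega) n

/-! ### The Cauchy–Goursat theorem -/

section Goursat

variable {n m : ℕ}

/-- The integrands of the directed boundary integral, as the components of a field. -/
noncomputable def boundaryField (φ : (Fin (n + 1) → ℝ) → Space m) (F : Space m → Multivector m)
    (i : Fin (n + 1)) (x : Fin (n + 1) → ℝ) : Multivector m :=
  (-1 : ℝ) ^ (n + (i : ℕ)) •
    (blade (fun j : Fin n => partialDeriv φ x (i.succAbove j)) * F (φ x))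

theorem boundaryIntegral_eq_flux (φ : (Fin (n + 1) → ℝ) → Space m)
    (F : Space m → Multivector m) (a : Fin (n + 1) → ℝ) (h : ℝ) :
    boundaryIntegral φ F a h = flux (boundaryField φ F) a h := by
  simp only [boundaryIntegral, faceIntegral, flux, boundaryField, integral_smul, smul_sub]

theorem continuousOn_tangentBlade {φ : (Fin (n + 1) → ℝ) → Space m}
    (hφ : ContDiffOn ℝ 1 φ (unitCube (n + 1))) (i : Fin (n + 1)) :
    ContinuousOn (fun x => blade fun j : Fin n => partialDeriv φ x (i.succAbove j))
      (unitCube (n + 1)) :=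
  (continuous_blade m n).comp_continuousOn
    (continuousOn_pi.2 fun j => continuousOn_partialDeriv hφ (i.succAbove j))

theorem continuousOn_boundaryField {φ : (Fin (n + 1) → ℝ) → Space m} {F : Space m → Multivector m}
    (hφ : ContDiffOn ℝ 1 φ (unitCube (n + 1))) (hF : ContinuousOn (F ∘ φ) (unitCube (n + 1)))
    (i : Fin (n + 1)) : ContinuousOn (boundaryField φ F i) (unitCube (n + 1)) :=
  ((continuousOn_tangentBlade hφ i).mul hF).const_smul ((-1 : ℝ) ^ (n + (i : ℕ)))

theorem flux_sub {E : Type*} [NormedAddCommGroup E] [NormedSpace ℝ E]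
    {G G' : Fin (n + 1) → (Fin (n + 1) → ℝ) → E} {a : Fin (n + 1) → ℝ} {h : ℝ} (hh : 0 ≤ h)
    (hG : ∀ i, ContinuousOn (G i) (cube a h)) (hG' : ∀ i, ContinuousOn (G' i) (cube a h)) :
    flux (fun i x => G i x - G' i x) a h = flux G a h - flux G' a h := by
  simp only [flux]
  rw [← Finset.sum_sub_distrib]
  refine Finset.sum_congr rfl fun i _ => ?_
  have hi : ∀ {H : Fin (n + 1) → (Fin (n + 1) → ℝ) → E}, (∀ i, ContinuousOn (H i) (cube a h)) →
      ∀ t, a i ≤ t ∧ t ≤ a i + h →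
      IntegrableOn (fun y => H i (Fin.insertNth (α := fun _ => ℝ) i t y))
        (cube (fun j => a (i.succAbove j)) h) := fun hH t ht =>
    (continuousOn_comp_insertNth (hH i) ht).integrableOn_compact (isCompact_cube _ _)
  rw [integral_sub (hi hG _ ⟨by linarith, le_rfl⟩) (hi hG' _ ⟨by linarith, le_rfl⟩),
    integral_sub (hi hG _ ⟨le_rfl, by linarith⟩) (hi hG' _ ⟨le_rfl, by linarith⟩)]
  abel

/-- The directed boundary integral of a constant vanishes. -/
theorem flux_boundaryField_const {φ : (Fin (n + 1) → ℝ) → Space m}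
    (hφ : ContDiffOn ℝ 1 φ (unitCube (n + 1))) (A : Multivector m) {a : Fin (n + 1) → ℝ} {h : ℝ}
    (hh : 0 < h) (hsub : cube a h ⊆ openUnitCube (n + 1)) :
    flux (boundaryField φ fun _ => A) a h = 0 := by
  -- Right multiplication by `A` turns the blade into a constant form. The factor `(-1) ^ n`
  -- reconciles the sign `(-1) ^ (n + i)` with the `(-1) ^ i` of the exterior derivative.
  let R : Multivector m →L[ℝ] Multivector m :=
    (-1 : ℝ) ^ n • ((LinearMap.mul ℝ (Multivector m)).flip A).toContinuousLinearMap
  rw [← flux_pullback (R.compContinuousAlternatingMap (bladeForm m n)) hφ hh hsub]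
  congr 1
  funext i x
  change _ = (-1 : ℝ) ^ (i : ℕ) • ((-1 : ℝ) ^ n • (bladeForm m n _ * A))
  rw [bladeForm_apply, smul_smul, ← pow_add, add_comm, boundaryField]

/-- The directed boundary integral is controlled by the oscillation of the integrand. -/
theorem exists_norm_flux_le_oscillation {φ : (Fin (n + 1) → ℝ) → Space m}
    {F : Space m → Multivector m} (hφ : ContDiffOn ℝ 1 φ (unitCube (n + 1)))
    (hF : ContinuousOn (F ∘ φ) (unitCube (n + 1))) :
    ∃ K : ℝ, 0 ≤ K ∧ ∀ (a : Fin (n + 1) → ℝ) (h ε : ℝ), 0 < h → 0 ≤ ε →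
      cube a h ⊆ openUnitCube (n + 1) →
      (∀ x ∈ cube a h, ‖F (φ x) - F (φ a)‖ ≤ ε) →
      ‖flux (boundaryField φ F) a h‖ ≤ K * ε * h ^ n := by
  obtain ⟨C, hC, hmul⟩ := exists_norm_mul_le m
  have hB : ∀ i : Fin (n + 1), ∃ B : ℝ, ∀ x ∈ unitCube (n + 1),
      ‖blade fun j : Fin n => partialDeriv φ x (i.succAbove j)‖ ≤ B := fun i =>
    (isCompact_unitCube _).exists_bound_of_continuousOn (continuousOn_tangentBlade hφ i)
  choose B hB using hB
  have hB0 : ∀ i, 0 ≤ B i := fun i =>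
    (norm_nonneg _).trans (hB i 0 ⟨le_rfl, fun _ => zero_le_one⟩)
  -- `2 * (n + 1)` counts the faces, `C` bounds multiplication, and `∑ i, B i` bounds all the
  -- tangent blades at once.
  refine ⟨2 * (n + 1) * (C * ∑ i, B i), mul_nonneg (by positivity)
    (mul_nonneg hC (Finset.sum_nonneg fun i _ => hB0 i)), fun a h ε hh hε hsub hosc => ?_⟩
  have hsub' := hsub.trans (openUnitCube_subset (n + 1))
  have heq : flux (boundaryField φ F) a h =
      flux (fun i x => boundaryField φ F i x - boundaryField φ (fun _ => F (φ a)) i x) a h := by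
    rw [flux_sub hh.le (fun i => (continuousOn_boundaryField hφ hF i).mono hsub')
      (fun i => (continuousOn_boundaryField hφ continuousOn_const i).mono hsub'),
      flux_boundaryField_const hφ _ hh hsub, sub_zero]
  rw [heq, show 2 * ((n : ℝ) + 1) * (C * ∑ i, B i) * ε * h ^ n =
    2 * (n + 1) * (C * (∑ i, B i) * ε) * h ^ n by ring]
  refine norm_flux_le hh.le fun i x hx => ?_
  rw [boundaryField, boundaryField, ← smul_sub, ← mul_sub, norm_smul, norm_pow, norm_neg, norm_one,
    one_pow, one_mul]
  refine (hmul _ _).trans (mul_le_mul (mul_le_mul_of_nonneg_left ?_ hC) (hosc x hx) (norm_nonneg _)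
    (mul_nonneg hC (Finset.sum_nonneg fun i _ => hB0 i)))
  exact (hB i x (hsub' hx)).trans
    (Finset.single_le_sum (fun i _ => hB0 i) (Finset.mem_univ i))

theorem imageVolume_pos {φ : (Fin (n + 1) → ℝ) → Space m}
    (hφ : ContDiffOn ℝ 1 φ (unitCube (n + 1)))
    (hJ : ∀ x ∈ openUnitCube (n + 1), 0 < jacobian φ x) {a : Fin (n + 1) → ℝ} {h : ℝ} (hh : 0 < h)
    (hsub : cube a h ⊆ openUnitCube (n + 1)) : 0 < imageVolume φ a h := by
  have hc := (continuousOn_jacobian hφ).mono (hsub.trans (openUnitCube_subset _))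
  obtain ⟨z, hz, hmin⟩ := (isCompact_cube a h).exists_isMinOn
    ⟨a, mem_cube.2 fun i => ⟨le_rfl, by linarith⟩⟩ hc
  have h1 : jacobian φ z * volume.real (cube a h) ≤ imageVolume φ a h :=
    setIntegral_ge_of_const_le_real (isCompact_cube a h).measurableSet (volume_cube_lt_top a h).ne
      (fun x hx => hmin hx) (hc.integrableOn_compact (isCompact_cube a h))
  refine lt_of_lt_of_le (mul_pos (hJ z (hsub hz)) ?_) h1
  rw [volume_real_cube a hh.le]; positivity

/-- This converts smallness relative to `|C|` into smallness relative to `h ^ (n + 1)`. -/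
theorem exists_imageVolume_le {φ : (Fin (n + 1) → ℝ) → Space m}
    (hφ : ContDiffOn ℝ 1 φ (unitCube (n + 1))) :
    ∃ J : ℝ, 0 < J ∧ ∀ (a : Fin (n + 1) → ℝ) (h : ℝ), 0 ≤ h → cube a h ⊆ unitCube (n + 1) →
      imageVolume φ a h ≤ J * h ^ (n + 1) := by
  obtain ⟨J, hJ⟩ := (isCompact_unitCube _).exists_bound_of_continuousOn (continuousOn_jacobian hφ)
  refine ⟨max J 1, by positivity, fun a h hh hsub => ?_⟩
  rw [← volume_real_cube a hh]
  exact (le_abs_self _).trans (norm_setIntegral_le_of_norm_le_const (volume_cube_lt_top a h)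
    fun x hx => (hJ x (hsub hx)).trans (le_max_left _ _))

/-- The boundary integrals of a cube on which the tangential derivative vanishes are zero. -/
theorem flux_eq_zero_of_hasTangentialDerivAt {φ : (Fin (n + 1) → ℝ) → Space m}
    {F : Space m → Multivector m} (hφ : ContDiffOn ℝ 1 φ (unitCube (n + 1)))
    (hJ : ∀ x ∈ openUnitCube (n + 1), 0 < jacobian φ x)
    (hF : ContinuousOn (F ∘ φ) (unitCube (n + 1))) {a : Fin (n + 1) → ℝ} {h : ℝ} (hh : 0 < h)
    (hsub : cube a h ⊆ openUnitCube (n + 1))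
    (hD : ∀ x ∈ cube a h, HasTangentialDerivAt φ F x 0) :
    flux (boundaryField φ F) a h = 0 := by
  have hsub' := hsub.trans (openUnitCube_subset (n + 1))
  obtain ⟨J, hJ0, hvol⟩ := exists_imageVolume_le hφ
  refine flux_eq_zero_of_density hh (fun i => (continuousOn_boundaryField hφ hF i).mono hsub')
    fun x hx ε hε => ?_
  obtain ⟨A, hA, hA0⟩ := hD x hx
  have hA' : A = 0 :=
    (isUnit_reverse (isUnit_tangent (hJ x (hsub hx)))).mul_right_eq_zero.1 hA0.symm
  subst hA'
  -- The tolerance `ε / J` absorbs the factor `J` in the volume bound.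
  have hev := (Metric.tendsto_nhds.1 hA) (ε / J) (by positivity)
  rw [cubesShrinkingTo, eventually_inf_principal] at hev
  obtain ⟨t, ht, hev⟩ := mem_comap.1 hev
  obtain ⟨d, hd, hdt⟩ := mem_nhdsGT_iff_exists_Ioo_subset.1 ht
  refine ⟨d, hd, fun a' h' hh' hlt hx' hsub'' => ?_⟩
  have h1 := @hev (a', h') (hdt ⟨hh', hlt⟩) ⟨hx', hsub''.trans hsub'⟩
  have hpos := imageVolume_pos hφ hJ hh' (hsub''.trans hsub)
  rw [dist_zero_right, norm_smul, norm_inv, Real.norm_of_nonneg hpos.le, boundaryIntegral_eq_flux,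
    inv_mul_lt_iff₀ hpos] at h1
  refine h1.le.trans ?_
  have h2 := mul_le_mul_of_nonneg_right (hvol a' h' hh'.le (hsub''.trans hsub'))
    (show 0 ≤ ε / J by positivity)
  refine h2.trans_eq ?_
  field_simp

open scoped Classical in
/-- Around each interior point the boundary integrals of small cubes are zero. -/
theorem exists_flux_eq_zero (M : Chain (n + 1) m) {F : Space m → Multivector m}
    {φ : SingularCube (n + 1) m} (hF : ContinuousOn (F ∘ φ.toFun) (unitCube (n + 1)))
    (hD : ∀ x ∈ openUnitCube (n + 1), φ.toFun x ∉ M.boundaryCarrier →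
      HasTangentialDerivAt φ.toFun F x 0)
    {x : Fin (n + 1) → ℝ} (hx : x ∈ openUnitCube (n + 1)) :
    ∃ d > 0, ∀ a h, 0 < h → h < d → x ∈ cube a h → cube a h ⊆ openUnitCube (n + 1) →
      flux (boundaryField φ.toFun F) a h = 0 := by
  obtain ⟨l, hl, d, hd, hanti⟩ :=
    exists_local_antilipschitz_bound φ.contDiffOn hx (φ.jacobian_pos x hx)
  refine ⟨d, hd, fun a h hh hlt hxc hsub => ?_⟩
  have hsub' := hsub.trans (openUnitCube_subset (n + 1))
  have hball : cube a h ⊆ Metric.ball x d := fun y hy => by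
    rw [Metric.mem_ball]
    refine (dist_pi_lt_iff hd).2 fun j => ?_
    rw [mem_cube] at hy hxc
    rw [Real.dist_eq, abs_lt]
    constructor <;> linarith [hy j, hxc j]
  have hcount : ∀ ψ : SingularCube (n + 1) m, ∃ C : ℕ, ∀ k : ℕ, 0 < k →
      (Finset.univ.filter fun s : Fin (n + 1) → Fin k =>
        ∃ p ∈ cube (fun j => a j + h / k * (s j : ℕ)) (h / k),
          φ.toFun p ∈ ψ.toFun '' (unitCube (n + 1) \ openUnitCube (n + 1))).card ≤ C * k ^ n := by
    intro ψ
    obtain ⟨L, hL, hLip⟩ := exists_lipschitz_bound ψ.contDiffOn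
    exact exists_card_meeting_le hh hl hL
      (fun y hy z hz => hanti y (hball hy) z (hball hz)) hLip
  choose C hC using hcount
  obtain ⟨K, hK, hosc⟩ := exists_norm_flux_le_oscillation φ.contDiffOn hF
  have hunif : UniformContinuousOn (F ∘ φ.toFun) (unitCube (n + 1)) :=
    (isCompact_unitCube _).uniformContinuousOn_of_continuous hF
  have key : ∀ ε > 0, ‖flux (boundaryField φ.toFun F) a h‖ ≤
      ((∑ ψ ∈ M.support, C ψ : ℕ) : ℝ) * (K * h ^ n) * ε := by
    intro ε hε
    obtain ⟨η, hη, hη'⟩ := Metric.uniformContinuousOn_iff.1 hunif ε hε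
    -- Parts of side `h / k < η` have oscillation of `F ∘ φ` at most `ε`.
    obtain ⟨k, hk⟩ := exists_nat_gt (h / η)
    have hk0' : (0 : ℝ) < k := lt_of_le_of_lt (by positivity) hk
    have hk0 : 0 < k := by exact_mod_cast hk0'
    have hδ : 0 < h / k := by positivity
    have hδη : h / k < η := by
      rw [div_lt_iff₀ hk0']; rw [div_lt_iff₀ hη] at hk; linarith
    have hkδ : (k : ℝ) * (h / k) = h := mul_div_cancel₀ h hk0'.ne'
    have hpart : ∀ s : Fin (n + 1) → Fin k,
        cube (fun j => a j + h / k * (s j : ℕ)) (h / k) ⊆ cube a h := fun s => by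
      have := subcube_subset a hδ.le s
      rwa [hkδ] at this
    have hdiv := flux_subdivide (k := k) (a := a) (G := boundaryField φ.toFun F) hδ
      (fun i => (continuousOn_boundaryField φ.contDiffOn hF i).mono (by rwa [hkδ]))
    rw [hkδ] at hdiv
    -- `S` collects the parts meeting some face image; on all others the tangential derivative
    -- vanishes throughout.
    let S : Finset (Fin (n + 1) → Fin k) := M.support.biUnion fun ψ =>
      Finset.univ.filter fun s : Fin (n + 1) → Fin k =>
        ∃ p ∈ cube (fun j => a j + h / k * (s j : ℕ)) (h / k),
          φ.toFun p ∈ ψ.toFun '' (unitCube (n + 1) \ openUnitCube (n + 1))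
    have hScard : S.card ≤ (∑ ψ ∈ M.support, C ψ) * k ^ n := by
      rw [Finset.sum_mul]
      exact Finset.card_biUnion_le.trans (Finset.sum_le_sum fun ψ _ => hC ψ k hk0)
    have hgood : ∀ s ∉ S,
        flux (boundaryField φ.toFun F) (fun j => a j + h / k * (s j : ℕ)) (h / k) = 0 := by
      intro s hs
      refine flux_eq_zero_of_hasTangentialDerivAt φ.contDiffOn φ.jacobian_pos hF hδ
        ((hpart s).trans hsub) fun y hy => hD y (hsub (hpart s hy)) fun hmem => hs ?_
      obtain ⟨ψ, hψ, hmem⟩ := Set.mem_iUnion₂.1 hmem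
      exact Finset.mem_biUnion.2 ⟨ψ, hψ, Finset.mem_filter.2 ⟨Finset.mem_univ _, y, hy, hmem⟩⟩
    have hbad : ∀ s ∈ S,
        ‖flux (boundaryField φ.toFun F) (fun j => a j + h / k * (s j : ℕ)) (h / k)‖ ≤
          K * ε * (h / k) ^ n := by
      intro s _
      have hcorner : (fun j => a j + h / k * ((s j : ℕ) : ℝ)) ∈
          cube (fun j => a j + h / k * (s j : ℕ)) (h / k) :=
        mem_cube.2 fun j => ⟨le_rfl, by linarith⟩
      refine hosc _ _ ε hδ hε.le ((hpart s).trans hsub) fun y hy => ?_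
      rw [← dist_eq_norm]
      refine (hη' y (hsub' (hpart s hy)) _ (hsub' (hpart s hcorner)) ?_).le
      refine (dist_pi_lt_iff hη).2 fun j => ?_
      rw [mem_cube] at hy
      rw [Real.dist_eq, abs_lt]
      constructor <;> linarith [hy j]
    rw [hdiv, ← Finset.sum_subset (Finset.subset_univ S) fun s _ hs => hgood s hs]
    -- The count `k ^ n` cancels the denominator of `(h / k) ^ n`, so the bound depends on `k` no
    -- longer.
    calc _ ≤ ∑ s ∈ S, K * ε * (h / k) ^ n := norm_sum_le_of_le _ hbad
      _ = (S.card : ℝ) * (K * ε * (h / k) ^ n) := by rw [Finset.sum_const, nsmul_eq_mul]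
      _ ≤ ((∑ ψ ∈ M.support, C ψ) * k ^ n : ℕ) * (K * ε * (h / k) ^ n) := by
          refine mul_le_mul_of_nonneg_right (by exact_mod_cast hScard) (by positivity)
      _ = _ := by
          push_cast
          rw [div_pow]
          field_simp
  refine norm_le_zero_iff.1 (ge_of_tendsto (x := 𝓝[>] (0 : ℝ))
    (f := fun ε => ((∑ ψ ∈ M.support, C ψ : ℕ) : ℝ) * (K * h ^ n) * ε) ?_ ?_)
  · have : Tendsto (fun ε : ℝ => ((∑ ψ ∈ M.support, C ψ : ℕ) : ℝ) * (K * h ^ n) * ε) (𝓝[>] 0)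
        (𝓝 (((∑ ψ ∈ M.support, C ψ : ℕ) : ℝ) * (K * h ^ n) * 0)) :=
      (tendsto_id.mono_left nhdsWithin_le_nhds).const_mul _
    simpa using this
  · filter_upwards [self_mem_nhdsWithin] with ε hε
    exact key ε hε

end Goursat

end GeometricCalculus

theorem mainTheorem4 (n m : ℕ) (M : GeometricCalculus.Chain (n + 1) m)
    (F : GeometricCalculus.Space m → GeometricCalculus.Multivector m)
    (hF : ContinuousOn F M.carrier)
    (hD : ∀ φ ∈ M.support, ∀ x ∈ GeometricCalculus.openUnitCube (n + 1),
      φ.toFun x ∉ M.boundaryCarrier →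
        GeometricCalculus.HasTangentialDerivAt φ.toFun F x 0) :
    M.boundaryIntegral F = 0 := by
  -- No cancellation between different cubes is needed.
  refine Finset.sum_eq_zero fun φ hφ => ?_
  have hFφ : ContinuousOn (F ∘ φ.toFun) (GeometricCalculus.unitCube (n + 1)) :=
    hF.comp φ.contDiffOn.continuousOn fun x hx =>
      Set.mem_iUnion₂.2 ⟨φ, hφ, Set.mem_image_of_mem _ hx⟩
  have hG := GeometricCalculus.continuousOn_boundaryField φ.contDiffOn hFφ
  have h0 : GeometricCalculus.boundaryIntegral φ.toFun F 0 1 = 0 := by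
    rw [GeometricCalculus.boundaryIntegral_eq_flux]
    -- The Jacobian may vanish on the boundary of the unit cube, so the local argument applies only
    -- to cubes kept away from it.
    refine GeometricCalculus.flux_unitCube_eq_zero hG fun δ h0 h1 => ?_
    have hsub : GeometricCalculus.cube (fun _ => δ) (1 - 2 * δ) ⊆
        GeometricCalculus.openUnitCube (n + 1) := fun y hy i => by
      have := GeometricCalculus.mem_cube.1 hy i
      constructor <;> linarith
    refine GeometricCalculus.flux_eq_zero_of_locally (by linarith)
      (fun i => (hG i).mono (hsub.trans (GeometricCalculus.openUnitCube_subset _))) fun x hx => ?_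
    obtain ⟨d, hd, hflux⟩ := GeometricCalculus.exists_flux_eq_zero M hFφ (hD φ hφ) (hsub hx)
    exact ⟨d, hd, fun a h hh hlt hxc hc => hflux a h hh hlt hxc (hc.trans hsub)⟩
  simp only [h0, smul_zero]
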